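/- \textbf{Polar transform and quantization.} Let $d=2^t$ with $t\ge 1$. For $y\in\mathbb R^d$ put $r^{(0)}=y$ and, for $\ell=1,\dots,t$ and $j=1,\dots,d/2^\ell$, let $r^{(\ell)}_j=\big\|\big(r^{(\ell-1)}_{2j-1},r^{(\ell-1)}_{2j}\big)\big\|_2$ and let $\psi^{(\ell)}_j$ be the polar angle of the point $\big(r^{(\ell-1)}_{2j-1},r^{(\ell-1)}_{2j}\big)$, i.e. the value of $\tan^{-1}\big(r^{(\ell-1)}_{2j}/r^{(\ell-1)}_{2j-1}\big)$ in $A_1=[0,2\pi)$ for $\ell=1$ and in $A_\ell=[0,\pi/2]$ for $\ell\ge 2$ (the angle of the origin is $0$). A $b$-bit quantizer of level $\ell$ consists of a partition of $A_\ell$ into $2^b$ (possibly empty) intervals $I^{(\ell)}_k$ and of centroids $\theta^{(\ell)}_k\in\mathbb R$, $k\in[2^b]$; it is optimal if it minimizes, among all such quantizers, the mean squared error $\mathbb E\sum_{k:\,\psi\in I^{(\ell)}_k}|\psi-\theta^{(\ell)}_k|^2$, where $\psi$ is distributed as a level-$\ell$ angle of a standard Gaussian vector (this law depends on $\ell$ only).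 Given $b$-bit quantizers for all levels and an orthogonal matrix $S\in\mathbb R^{d\times d}$ (for instance $S=I_d$), a row vector $x\in\mathbb R^d$ is encoded by the final radius $r^{(t)}_1$ of the polar transform of $y=xS$, together with the indices $J^{(\ell)}_j=\operatorname{argmin}_{k\in[2^b]}|\theta^{(\ell)}_k-\psi^{(\ell)}_j|$ (the least one in case of a tie) for $1\le\ell\le t$, $1\le j\le d/2^\ell$. Decoding puts $\hat r^{(t)}_1=r^{(t)}_1$ and, for $\ell=t,\dots,1$ and every $j$, $\hat r^{(\ell-1)}_{2j-1}=\hat r^{(\ell)}_j\cos\theta^{(\ell)}_{J^{(\ell)}_j}$, $\hat r^{(\ell-1)}_{2j}=\hat r^{(\ell)}_j\sin\theta^{(\ell)}_{J^{(\ell)}_j}$, and returns $x'=\hat r^{(0)}S^{\top}$. \textbf{Theorem.} There is an absolute constant $C>0$ such that for every $\varepsilon\in(0,1/2]$ there is a bit width $b$ for which optimal $b$-bit quantizers exist at all levels and the following holds for every $d=2^t$ with $t\ge1$. The indices of the $d-1$ angles of a $d$-dimensional vector take at most $C\log(1/\varepsilon)\cdot d$ bits, that is, $O(\log(1/\varepsilon))$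 bits per coordinate. Moreover, for all choices of optimal $b$-bit quantizers of the levels $1,\dots,t$ and every orthogonal $S$, the only other number stored is $r^{(t)}_1=\|x\|_2$, and for $x\sim\mathcal N(0,I_d)$ the squared error $\|x-x'\|_2^2$ is integrable and satisfies \[ \mathbb E\big[\|x-x'\|_2^2\,\big|\,\|x\|_2\big]\le\varepsilon\,\|x\|_2^2\quad\text{almost surely},\qquad \mathbb E\,\|x-x'\|_2^2\le\varepsilon\, d=\varepsilon\,\mathbb E\|x\|_2^2 . \] -/

import Mathlib

open MeasureTheory ProbabilityTheory
open scoped Matrix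

noncomputable section

/-- Polar angle in `[0, 2π)` of the point `(a, b)` of the plane, i.e. the branch of `arctan (b / a)`
that recovers `(a, b)` from its modulus. If `a, b ≥ 0` it lies in `[0, π/2]`. The angle of the
origin is `0`. -/
def planeAngle (a b : ℝ) : ℝ :=
  if 0 ≤ Complex.arg ⟨a, b⟩ then Complex.arg ⟨a, b⟩ else Complex.arg ⟨a, b⟩ + 2 * Real.pi

/-- The radii `r^(ℓ)_j` of the recursive polar transform of `y`, with coordinates counted from `0`:
`r^(0) = y` and `r^(ℓ+1)_j` is the Euclidean norm of the pair `(r^(ℓ)_{2j}, r^(ℓ)_{2j+1})`. -/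
def polarRadius (y : ℕ → ℝ) : ℕ → ℕ → ℝ
  | 0, j => y j
  | ℓ + 1, j => √((polarRadius y ℓ (2 * j)) ^ 2 + (polarRadius y ℓ (2 * j + 1)) ^ 2)

/-- The angle computed from the `j`-th pair of the radii `r^(ℓ)`. Levels are counted from `0` here:
`polarAngle y ℓ` is the vector `ψ^(ℓ+1)` of the literature, so level `0` is the one with
angles in `[0, 2π)`. -/
def polarAngle (y : ℕ → ℝ) (ℓ j : ℕ) : ℝ :=
  planeAngle (polarRadius y ℓ (2 * j)) (polarRadius y ℓ (2 * j + 1))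

/-- The range of the angles of a level. -/
def angleRange (ℓ : ℕ) : Set ℝ :=
  if ℓ = 0 then Set.Ico 0 (2 * Real.pi) else Set.Icc 0 (Real.pi / 2)

/-- The coordinates of a vector of dimension `2 ^ t` as a sequence, padded by `0`. -/
def coords {t : ℕ} (y : EuclideanSpace ℝ (Fin (2 ^ t))) (i : ℕ) : ℝ :=
  if h : i < 2 ^ t then y ⟨i, h⟩ else 0

/-- Law of one angle of level `ℓ` of a standard Gaussian vector: the angle of that level computed
from a block of `2 ^ (ℓ + 1)` independent standard Gaussian coordinates. -/
def angleLaw (ℓ : ℕ) : Measure ℝ :=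
  (stdGaussian (EuclideanSpace ℝ (Fin (2 ^ (ℓ + 1))))).map fun y => polarAngle (coords y) ℓ 0

/-- A `b`-bit scalar quantizer for the angles of level `ℓ`: a partition of their range into `2 ^ b`
intervals (some may be empty), with a centroid for each interval. -/
structure AngleQuantizer (b ℓ : ℕ) where
  cell : Fin (2 ^ b) → Set ℝ
  centroid : Fin (2 ^ b) → ℝ
  ordConnected : ∀ k, (cell k).OrdConnected
  disjoint : Pairwise fun k k' => Disjoint (cell k) (cell k')
  iUnion_cell : ⋃ k, cell k = angleRange ℓ

/-- Mean squared error of the quantizer on a level-`ℓ` angle of a standard Gaussian vector. -/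
def AngleQuantizer.cost {b ℓ : ℕ} (q : AngleQuantizer b ℓ) : ℝ :=
  ∫ ψ, ∑ k, (q.cell k).indicator (fun φ => |φ - q.centroid k| ^ 2) ψ ∂(angleLaw ℓ)

/-- The quantizer minimizes the mean squared error among all `b`-bit quantizers of its level. -/
def AngleQuantizer.IsOptimal {b ℓ : ℕ} (q : AngleQuantizer b ℓ) : Prop :=
  ∀ q' : AngleQuantizer b ℓ, q.cost ≤ q'.cost

theorem exists_nearest {b : ℕ} (θ : Fin (2 ^ b) → ℝ) (ψ : ℝ) :
    (Finset.univ.filter fun k => ∀ k', |θ k - ψ| ≤ |θ k' - ψ|).Nonempty := by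
  obtain ⟨k, hk⟩ := Finite.exists_min fun k => |θ k - ψ|
  exact ⟨k, by simpa using hk⟩

/-- `argmin_k |θ_k - ψ|`, the smallest such `k` in case of a tie. -/
def quantIndex {b : ℕ} (θ : Fin (2 ^ b) → ℝ) (ψ : ℝ) : Fin (2 ^ b) :=
  (Finset.univ.filter fun k => ∀ k', |θ k - ψ| ≤ |θ k' - ψ|).min' (exists_nearest θ ψ)

/-- The stored angle indices: in dimension `2 ^ t` there are `t` levels, level `ℓ` (counted from
`0`) has `2 ^ t / 2 ^ (ℓ + 1)` angles, and each is stored as an index into `2 ^ b` centroids. -/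
abbrev AngleCode (t b : ℕ) : Type :=
  (ℓ : Fin t) → Fin (2 ^ (t - 1 - (ℓ : ℕ))) → Fin (2 ^ b)

/-- The number of bits needed to store an element of `AngleCode t b`. -/
def angleBits (t b : ℕ) : ℕ := Nat.clog 2 (Nat.card (AngleCode t b))

/-- The polar quantization of the (row) vector `x` with preconditioner `S`: the final radius of the
polar transform of `x S`, and the indices of the quantized angles. -/
def polarQuant {t b : ℕ} (Q : ∀ ℓ, AngleQuantizer b ℓ) (S : Matrix (Fin (2 ^ t)) (Fin (2 ^ t)) ℝ)
    (x : EuclideanSpace ℝ (Fin (2 ^ t))) : ℝ × AngleCode t b :=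
  let y := coords (WithLp.toLp 2 (x.ofLp ᵥ* S))
  (polarRadius y t 0, fun ℓ j => quantIndex (Q ℓ).centroid (polarAngle y ℓ j))

/-- The centroids selected by the stored indices. -/
def codeAngle {t b : ℕ} (Q : ∀ ℓ, AngleQuantizer b ℓ) (J : AngleCode t b) (ℓ j : ℕ) : ℝ :=
  if h : ℓ < t then
    if h' : j < 2 ^ (t - 1 - ℓ) then (Q ℓ).centroid (J ⟨ℓ, h⟩ ⟨j, h'⟩) else 0
  else 0

/-- The inverse polar transform with `t` levels. The radii of level `1` are reconstructed from the
final radius `r` and the angles of the upper levels; then radius `j` is split into the coordinates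
`2j` and `2j + 1` by multiplying it by the cosine and the sine of the `j`-th lowest-level angle. -/
def polarInv : (t : ℕ) → (r : ℝ) → (φ : ℕ → ℕ → ℝ) → ℕ → ℝ
  | 0, r, _, _ => r
  | t + 1, r, φ, i =>
      polarInv t r (fun ℓ => φ (ℓ + 1)) (i / 2) *
        if i % 2 = 0 then Real.cos (φ 0 (i / 2)) else Real.sin (φ 0 (i / 2))

/-- Dequantization: the inverse polar transform of the stored data, multiplied by `Sᵀ`. -/
def polarDequant {t b : ℕ} (Q : ∀ ℓ, AngleQuantizer b ℓ)
    (S : Matrix (Fin (2 ^ t)) (Fin (2 ^ t)) ℝ) (c : ℝ × AngleCode t b) :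
    EuclideanSpace ℝ (Fin (2 ^ t)) :=
  WithLp.toLp 2 ((fun i : Fin (2 ^ t) => polarInv t c.1 (codeAngle Q c.2) i) ᵥ* Sᵀ)

end

/-! Write `y = xS` and let `ŷ` be the vector decoded before multiplication by `Sᵀ`. Splitting a
radius into cosine and sine preserves the norm for any angle, so `‖ŷ‖ = ‖y‖` and the error equals
`2‖x‖² - 2⟨y, ŷ⟩`. In the inner product, a pair with radius `ρ`, decoded radius `ρ'`, angle `ψ` and
centroid `θ` contributes `ρρ' cos (ψ - θ)`, so the levels can be peeled off one at a time
(`sum_mul_polarRecon_succ`).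

For Gaussian `y`, each angle is independent of all radii of the next level
(`indepFun_polarAngle_polarRadius`), and these determine everything that multiplies its cosine, the
norm included. Hence the conditional expectation of `⟨y, ŷ⟩` given the norm is exactly `P‖y‖²`,
where `P` is the product over the levels of the means `E cos (ψ - θ)`
(`integral_mul_sum_polarRecon`). Only `2 - 2P ≤ ε` remains.

Since `1 - cos u ≤ u²/2`, the quantity `2 - 2P` is at most the sum over the levels of the mean
squared quantization errors. Optimality bounds each error by that of any chosen centroids: a uniform
grid gives `40 / 4 ^ b`, and at upper levels the single centroid `π/4` gives `25 / 2 ^ ℓ`, because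
there the angle concentrates (`integral_cos_two_mul_sq_angleLaw_le`). Using the grid below level
`2b` and concentration above it makes the sum at most `130 / 2 ^ b` in every dimension, so `b =
O(log (1/ε))` suffices. -/

/-! ### Norm and direction of a Gaussian vector -/

/-- The standard Gaussian measure has a density that depends on the norm only. -/
theorem stdGaussian_eq_withDensity (E : Type*) [NormedAddCommGroup E] [InnerProductSpace ℝ E]
    [FiniteDimensional ℝ E] [MeasurableSpace E] [BorelSpace E] :
    stdGaussian E = (volume : Measure E).withDensity fun x => ENNReal.ofReal
      (((2 * Real.pi) ^ ((Module.finrank ℝ E : ℝ) / 2))⁻¹ * Real.exp (-‖x‖ ^ 2 / 2)) := by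
  set K : ℝ := ((2 * Real.pi) ^ ((Module.finrank ℝ E : ℝ) / 2))⁻¹ with hK
  have hpos : 0 < (2 * Real.pi) ^ ((Module.finrank ℝ E : ℝ) / 2) :=
    Real.rpow_pos_of_pos (by positivity) _
  have hK0 : 0 ≤ K := by positivity
  have hb : 0 < ((1 / 2 : ℂ)).re := by norm_num
  have hint : Integrable fun x : E => K * Real.exp (-‖x‖ ^ 2 / 2) := by
    have h := (GaussianFourier.integrable_cexp_neg_mul_sq_norm_add hb 0 (0 : E)).norm
    refine (h.congr (ae_of_all _ fun x => ?_)).const_mul K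
    simp only [Complex.norm_exp]
    congr 1
    simp [← Complex.ofReal_pow]
    ring
  have hnn : ∀ x : E, 0 ≤ K * Real.exp (-‖x‖ ^ 2 / 2) := fun x => by positivity
  have hfin : IsFiniteMeasure ((volume : Measure E).withDensity fun x => ENNReal.ofReal
      (K * Real.exp (-‖x‖ ^ 2 / 2))) :=
    isFiniteMeasure_withDensity_ofReal hint.2
  -- Both characteristic functions are explicit: the Fourier integral of the density is a complex
  -- Gaussian integral.
  apply Measure.ext_of_charFun
  ext t
  rw [charFun_stdGaussian, charFun_apply]
  have hmeas : Measurable fun x : E => (K * Real.exp (-‖x‖ ^ 2 / 2)).toNNReal := by fun_prop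
  change _ = ∫ x, _ ∂(volume.withDensity fun x : E =>
    (((K * Real.exp (-‖x‖ ^ 2 / 2)).toNNReal : NNReal) : ENNReal))
  rw [integral_withDensity_eq_integral_smul hmeas]
  have h := GaussianFourier.integral_cexp_neg_mul_sq_norm_add hb Complex.I t
  have e : ∀ x : E, ((K * Real.exp (-‖x‖ ^ 2 / 2)).toNNReal : NNReal) •
      Complex.exp (((inner ℝ x t : ℝ) : ℂ) * Complex.I) =
      (K : ℂ) * Complex.exp (-(1 / 2) * (‖x‖ : ℂ) ^ 2 + Complex.I * (inner ℝ t x : ℝ)) := by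
    intro x
    rw [NNReal.smul_def, Real.coe_toNNReal _ (hnn x), Complex.real_smul, Complex.exp_add,
      real_inner_comm]
    push_cast
    ring_nf
  simp_rw [e]
  rw [integral_const_mul, h, hK]
  have h2 : ((Real.pi : ℂ) / (1 / 2)) ^ ((Module.finrank ℝ E : ℂ) / 2) =
      (((2 * Real.pi) ^ ((Module.finrank ℝ E : ℝ) / 2) : ℝ) : ℂ) := by
    rw [Complex.ofReal_cpow (by positivity)]
    push_cast
    congr 1
    ring
  rw [h2, ← mul_assoc, ← Complex.ofReal_mul, inv_mul_cancel₀ hpos.ne']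
  simp only [Complex.ofReal_one, one_mul, Complex.I_sq]
  ring_nf

/-- Under the standard Gaussian measure the norm is independent of every function of the
direction. -/
theorem indepFun_norm_stdGaussian {E β : Type*} [NormedAddCommGroup E] [InnerProductSpace ℝ E]
    [FiniteDimensional ℝ E] [Nontrivial E] [MeasurableSpace E] [BorelSpace E] [MeasurableSpace β]
    {g : E → β} (hg : Measurable g) (hom : ∀ c : ℝ, 0 < c → ∀ x, g (c • x) = g x) :
    IndepFun g (fun x => ‖x‖) (stdGaussian E) := by
  set ρ : ℝ → ENNReal := fun r => ENNReal.ofReal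
      (((2 * Real.pi) ^ ((Module.finrank ℝ E : ℝ) / 2))⁻¹ * Real.exp (-r ^ 2 / 2)) with hρ
  have hρm : Measurable ρ := by fun_prop
  -- In polar coordinates Lebesgue measure is a product. The density sees only the radius and `g`
  -- only the sphere, so the joint measure factors, up to normalization.
  have key : ∀ (s : Set β) (u : Set ℝ), MeasurableSet s → MeasurableSet u →
      stdGaussian E (g ⁻¹' s ∩ (fun x => ‖x‖) ⁻¹' u) =
        (volume : Measure E).toSphere ((fun x => g x.1) ⁻¹' s) *
          ∫⁻ r, u.indicator ρ r.1 ∂(Measure.volumeIoiPow (Module.finrank ℝ E - 1)) := by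
    intro s u hs hu
    have hsm : MeasurableSet (g ⁻¹' s) := hg hs
    have hum : MeasurableSet ((fun x : E => ‖x‖) ⁻¹' u) := measurable_norm hu
    rw [stdGaussian_eq_withDensity, withDensity_apply _ (hsm.inter hum),
      ← lintegral_indicator (hsm.inter hum)]
    have hmp := (volume : Measure E).measurePreserving_homeomorphUnitSphereProd
    have h1 : ∫⁻ x, (g ⁻¹' s ∩ (fun x => ‖x‖) ⁻¹' u).indicator (fun x => ρ ‖x‖) x
          ∂(volume : Measure E) =
        ∫⁻ x : ({0}ᶜ : Set E), (g ⁻¹' s ∩ (fun x => ‖x‖) ⁻¹' u).indicator (fun x => ρ ‖x‖) x.1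
          ∂((volume : Measure E).comap (↑)) := by
      rw [lintegral_subtype_comap (measurableSet_singleton _).compl
        (fun x => (g ⁻¹' s ∩ (fun x => ‖x‖) ⁻¹' u).indicator (fun x => ρ ‖x‖) x),
        restrict_compl_singleton]
    have h2 : ∀ x : ({0}ᶜ : Set E),
        (g ⁻¹' s ∩ (fun x => ‖x‖) ⁻¹' u).indicator (fun x => ρ ‖x‖) x.1 =
        (fun p : Metric.sphere (0 : E) 1 × Set.Ioi (0 : ℝ) =>
          (((fun x : Metric.sphere (0 : E) 1 => g x.1) ⁻¹' s).indicator 1 p.1) *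
            u.indicator ρ p.2.1) (homeomorphUnitSphereProd E x) := by
      intro x
      have hx : (0 : ℝ) < ‖(x : E)‖⁻¹ := inv_pos.2 (norm_pos_iff.2 x.2)
      have e1 : ((homeomorphUnitSphereProd E x).1 : E) = ‖(x : E)‖⁻¹ • (x : E) := by simp
      have e2 : ((homeomorphUnitSphereProd E x).2 : ℝ) = ‖(x : E)‖ := by simp
      have e3 := hom _ hx (x : E)
      simp only [Set.indicator, Set.mem_inter_iff, Set.mem_preimage, e1, e2]
      by_cases h1 : g x ∈ s <;> by_cases h2 : ‖(x : E)‖ ∈ u <;> simp [h1, h2, e3]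
    have hs' : MeasurableSet ((fun x : Metric.sphere (0 : E) 1 => g x.1) ⁻¹' s) :=
      (hg.comp measurable_subtype_coe) hs
    have hm1 : Measurable fun x : Metric.sphere (0 : E) 1 =>
        (((fun x : Metric.sphere (0 : E) 1 => g x.1) ⁻¹' s).indicator
          (1 : Metric.sphere (0 : E) 1 → ENNReal) x) :=
      measurable_one.indicator hs'
    have hm2 : Measurable fun r : Set.Ioi (0 : ℝ) => u.indicator ρ r.1 :=
      (hρm.indicator hu).comp measurable_subtype_coe
    change ∫⁻ x, (g ⁻¹' s ∩ (fun x => ‖x‖) ⁻¹' u).indicator (fun x => ρ ‖x‖) x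
          ∂(volume : Measure E) = _
    rw [h1, (lintegral_congr h2).trans
      (hmp.lintegral_comp ((hm1.comp measurable_fst).mul (hm2.comp measurable_snd)))]
    simp only [Pi.mul_apply, Function.comp_apply]
    rw [lintegral_prod_mul hm1.aemeasurable hm2.aemeasurable,
      lintegral_indicator_one hs']
  rw [indepFun_iff_measure_inter_preimage_eq_mul]
  intro s u hs hu
  -- Full sets give the two marginals and the total mass `1`, which supplies the normalization.
  have k1 := key s Set.univ hs .univ
  have k2 := key Set.univ u .univ hu
  have k3 := key Set.univ Set.univ .univ .univ
  simp only [Set.preimage_univ, Set.inter_univ, Set.univ_inter, measure_univ] at k1 k2 k3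
  rw [key s u hs hu, k1, k2]
  set a := (volume : Measure E).toSphere ((fun x => g x.1) ⁻¹' s)
  set B := ∫⁻ r, u.indicator ρ r.1 ∂(Measure.volumeIoiPow (Module.finrank ℝ E - 1))
  calc a * B = a * B * 1 := (mul_one _).symm
    _ = _ := by rw [k3]; ring

/-! ### Algebra of the polar transform -/

theorem sqrt_mul_cos_planeAngle (a b : ℝ) : √(a ^ 2 + b ^ 2) * Real.cos (planeAngle a b) = a := by
  have h : Real.cos (planeAngle a b) = Real.cos (Complex.arg ⟨a, b⟩) := by
    unfold planeAngle; split_ifs <;> simp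
  have := Complex.norm_mul_cos_arg ⟨a, b⟩
  rwa [Complex.norm_eq_sqrt_sq_add_sq, ← h] at this

theorem sqrt_mul_sin_planeAngle (a b : ℝ) : √(a ^ 2 + b ^ 2) * Real.sin (planeAngle a b) = b := by
  have h : Real.sin (planeAngle a b) = Real.sin (Complex.arg ⟨a, b⟩) := by
    unfold planeAngle; split_ifs <;> simp
  have := Complex.norm_mul_sin_arg ⟨a, b⟩
  rwa [Complex.norm_eq_sqrt_sq_add_sq, ← h] at this

theorem planeAngle_mul {c : ℝ} (hc : 0 < c) (a b : ℝ) :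
    planeAngle (c * a) (c * b) = planeAngle a b := by
  have h : Complex.arg ⟨c * a, c * b⟩ = Complex.arg ⟨a, b⟩ := by
    rw [← Complex.arg_real_mul ⟨a, b⟩ hc]
    congr 1
    apply Complex.ext <;> simp
  simp only [planeAngle, h]

theorem measurable_planeAngle : Measurable fun p : ℝ × ℝ => planeAngle p.1 p.2 := by
  have h : Measurable fun p : ℝ × ℝ => Complex.arg ⟨p.1, p.2⟩ :=
    Complex.measurable_arg.comp Complex.measurableEquivRealProd.symm.measurable
  exact Measurable.ite (measurableSet_le measurable_const h) h (h.add_const _)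

theorem planeAngle_mem_Ico (a b : ℝ) : planeAngle a b ∈ Set.Ico 0 (2 * Real.pi) := by
  have h1 := Complex.neg_pi_lt_arg ⟨a, b⟩
  have h2 := Complex.arg_le_pi ⟨a, b⟩
  have := Real.pi_pos
  unfold planeAngle
  split_ifs with h
  · exact ⟨h, by linarith⟩
  · exact ⟨by linarith, by linarith⟩

theorem planeAngle_mem_Icc {a b : ℝ} (ha : 0 ≤ a) (hb : 0 ≤ b) :
    planeAngle a b ∈ Set.Icc 0 (Real.pi / 2) := by
  have h1 : 0 ≤ Complex.arg ⟨a, b⟩ := Complex.arg_nonneg_iff.2 hb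
  have h2 : Complex.arg ⟨a, b⟩ ≤ Real.pi / 2 := Complex.arg_le_pi_div_two_iff.2 (Or.inl ha)
  unfold planeAngle
  rw [if_pos h1]
  exact ⟨h1, h2⟩

theorem polarRadius_add (y : ℕ → ℝ) (ℓ m j : ℕ) :
    polarRadius y (ℓ + m) j = polarRadius (polarRadius y ℓ) m j := by
  induction m generalizing j with
  | zero => rfl
  | succ m ih => rw [← add_assoc, polarRadius, polarRadius, ih, ih]

theorem polarAngle_add (y : ℕ → ℝ) (ℓ m j : ℕ) :
    polarAngle y (ℓ + m) j = polarAngle (polarRadius y ℓ) m j := by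
  simp only [polarAngle, polarRadius_add]

theorem polarRadius_mul {c : ℝ} (hc : 0 ≤ c) (y : ℕ → ℝ) (ℓ j : ℕ) :
    polarRadius (fun i => c * y i) ℓ j = c * polarRadius y ℓ j := by
  induction ℓ generalizing j with
  | zero => rfl
  | succ ℓ ih =>
    rw [polarRadius, polarRadius, ih, ih]
    conv_rhs => rw [← Real.sqrt_sq hc, ← Real.sqrt_mul (sq_nonneg c)]
    congr 1
    ring

theorem polarAngle_mul {c : ℝ} (hc : 0 < c) (y : ℕ → ℝ) (ℓ j : ℕ) :
    polarAngle (fun i => c * y i) ℓ j = polarAngle y ℓ j := by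
  simp only [polarAngle, polarRadius_mul hc.le, planeAngle_mul hc]

theorem polarRadius_nonneg (y : ℕ → ℝ) {ℓ : ℕ} (hℓ : ℓ ≠ 0) (j : ℕ) : 0 ≤ polarRadius y ℓ j := by
  obtain ⟨m, rfl⟩ := Nat.exists_eq_succ_of_ne_zero hℓ
  exact Real.sqrt_nonneg _

theorem polarAngle_mem_angleRange (y : ℕ → ℝ) (ℓ j : ℕ) : polarAngle y ℓ j ∈ angleRange ℓ := by
  unfold angleRange
  split_ifs with h
  · exact planeAngle_mem_Ico _ _
  · exact planeAngle_mem_Icc (polarRadius_nonneg y h _) (polarRadius_nonneg y h _)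

theorem Finset.sum_range_two_mul {M : Type*} [AddCommMonoid M] (f : ℕ → M) (n : ℕ) :
    ∑ i ∈ Finset.range (2 * n), f i = ∑ j ∈ Finset.range n, (f (2 * j) + f (2 * j + 1)) := by
  induction n with
  | zero => simp
  | succ n ih =>
    rw [show 2 * (n + 1) = 2 * n + 1 + 1 by ring, Finset.sum_range_succ, Finset.sum_range_succ, ih,
      Finset.sum_range_succ, add_assoc]

theorem polarRadius_sq (y : ℕ → ℝ) (ℓ j : ℕ) :
    polarRadius y ℓ j ^ 2 = ∑ i ∈ Finset.range (2 ^ ℓ), y (j * 2 ^ ℓ + i) ^ 2 := by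
  induction ℓ generalizing j with
  | zero => simp [polarRadius]
  | succ ℓ ih =>
    rw [polarRadius, Real.sq_sqrt (by positivity), ih, ih, pow_succ, mul_two,
      Finset.sum_range_add]
    congr 1 <;> refine Finset.sum_congr rfl fun i _ => ?_ <;> congr 2 <;> ring

theorem polarRadius_congr {y z : ℕ → ℝ} {ℓ j : ℕ}
    (h : ∀ i < 2 ^ ℓ, y (j * 2 ^ ℓ + i) = z (j * 2 ^ ℓ + i)) :
    polarRadius y ℓ j = polarRadius z ℓ j := by
  -- Level `0` holds signed coordinates, which their squares do not determine.
  rcases Nat.eq_zero_or_pos ℓ with rfl | hℓ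
  · simpa [polarRadius] using h
  · rw [← sq_eq_sq₀ (polarRadius_nonneg y hℓ.ne' j) (polarRadius_nonneg z hℓ.ne' j),
      polarRadius_sq, polarRadius_sq]
    exact Finset.sum_congr rfl fun i hi => by rw [h i (Finset.mem_range.1 hi)]

theorem polarRadius_shift (y : ℕ → ℝ) (ℓ a j : ℕ) :
    polarRadius (fun i => y (a * 2 ^ ℓ + i)) ℓ j = polarRadius y ℓ (a + j) := by
  induction ℓ generalizing a j with
  | zero => simp [polarRadius]
  | succ ℓ ih =>
    rw [polarRadius, polarRadius]
    have : (fun i => y (a * 2 ^ (ℓ + 1) + i)) = fun i => y (2 * a * 2 ^ ℓ + i) := by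
      funext i; congr 1; ring
    rw [this, ih, ih, mul_add, add_assoc]

theorem polarAngle_shift (y : ℕ → ℝ) (ℓ j : ℕ) :
    polarAngle (fun i => y (j * 2 ^ (ℓ + 1) + i)) ℓ 0 = polarAngle y ℓ j := by
  have : (fun i => y (j * 2 ^ (ℓ + 1) + i)) = fun i => y (2 * j * 2 ^ ℓ + i) := by
    funext i; congr 1; ring
  rw [polarAngle, polarAngle, this, polarRadius_shift, polarRadius_shift]
  simp only [mul_zero, zero_add, add_zero]

theorem measurable_polarRadius (ℓ j : ℕ) : Measurable fun y : ℕ → ℝ => polarRadius y ℓ j := by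
  induction ℓ generalizing j with
  | zero => exact measurable_pi_apply j
  | succ ℓ ih =>
    simp only [polarRadius]
    exact (((ih _).pow_const 2).add ((ih _).pow_const 2)).sqrt

theorem measurable_polarAngle (ℓ j : ℕ) : Measurable fun y : ℕ → ℝ => polarAngle y ℓ j :=
  measurable_planeAngle.comp
    ((measurable_polarRadius ℓ (2 * j)).prodMk (measurable_polarRadius ℓ (2 * j + 1)))

theorem polarRadius_mul_cos (y : ℕ → ℝ) (ℓ j : ℕ) :
    polarRadius y (ℓ + 1) j * Real.cos (polarAngle y ℓ j) = polarRadius y ℓ (2 * j) :=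
  sqrt_mul_cos_planeAngle _ _

theorem polarRadius_mul_sin (y : ℕ → ℝ) (ℓ j : ℕ) :
    polarRadius y (ℓ + 1) j * Real.sin (polarAngle y ℓ j) = polarRadius y ℓ (2 * j + 1) :=
  sqrt_mul_sin_planeAngle _ _

/-! ### Inverse transform and reconstruction -/

theorem polarInv_congr {m : ℕ} {φ χ : ℕ → ℕ → ℝ} (r : ℝ)
    (h : ∀ l < m, ∀ k < 2 ^ (m - 1 - l), φ l k = χ l k) {i : ℕ} (hi : i < 2 ^ m) :
    polarInv m r φ i = polarInv m r χ i := by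
  induction m generalizing φ χ i with
  | zero => rfl
  | succ m ih =>
    have hi' : i / 2 < 2 ^ m := by
      rw [pow_succ] at hi; omega
    rw [polarInv, polarInv, h 0 (Nat.succ_pos m) (i / 2) (by simpa using hi')]
    rw [ih (φ := fun ℓ => φ (ℓ + 1)) (χ := fun ℓ => χ (ℓ + 1)) _ hi']
    intro l hl k hk
    exact h (l + 1) (by omega) k (by rwa [show m + 1 - 1 - (l + 1) = m - 1 - l by omega])

theorem polarInv_two_mul (m : ℕ) (r : ℝ) (φ : ℕ → ℕ → ℝ) (j : ℕ) :
    polarInv (m + 1) r φ (2 * j) = polarInv m r (fun ℓ => φ (ℓ + 1)) j * Real.cos (φ 0 j) := by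
  simp [polarInv]

theorem polarInv_two_mul_add_one (m : ℕ) (r : ℝ) (φ : ℕ → ℕ → ℝ) (j : ℕ) :
    polarInv (m + 1) r φ (2 * j + 1) =
      polarInv m r (fun ℓ => φ (ℓ + 1)) j * Real.sin (φ 0 j) := by
  have h : (2 * j + 1) / 2 = j := by omega
  simp [polarInv, h]

/-- Each split uses `cos² + sin² = 1`, so the angles need not come from any vector. -/
theorem sum_polarInv_sq (m : ℕ) (r : ℝ) (φ : ℕ → ℕ → ℝ) :
    ∑ i ∈ Finset.range (2 ^ m), polarInv m r φ i ^ 2 = r ^ 2 := by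
  induction m generalizing φ with
  | zero => simp [polarInv]
  | succ m ih =>
    rw [pow_succ', Finset.sum_range_two_mul, ← ih fun ℓ => φ (ℓ + 1)]
    refine Finset.sum_congr rfl fun j _ => ?_
    rw [polarInv_two_mul, polarInv_two_mul_add_one]
    linear_combination polarInv m r (fun ℓ => φ (ℓ + 1)) j ^ 2 * Real.sin_sq_add_cos_sq (φ 0 j)

/-- The vector recovered from the norm of `R` and the angles of its polar transform with `m` levels,
after the angles of level `ℓ` have been replaced by their images under `q ℓ`. -/
noncomputable def polarRecon (q : ℕ → ℝ → ℝ) (m : ℕ) (R : ℕ → ℝ) (i : ℕ) : ℝ :=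
  polarInv m (polarRadius R m 0) (fun l k => q l (polarAngle R l k)) i

theorem sum_polarRecon_sq (q : ℕ → ℝ → ℝ) (m : ℕ) (R : ℕ → ℝ) :
    ∑ i ∈ Finset.range (2 ^ m), polarRecon q m R i ^ 2 = polarRadius R m 0 ^ 2 :=
  sum_polarInv_sq _ _ _

theorem polarRecon_succ_aux (q : ℕ → ℝ → ℝ) (m : ℕ) (R : ℕ → ℝ) (j : ℕ) :
    polarInv m (polarRadius R (m + 1) 0) (fun l k => q (l + 1) (polarAngle R (l + 1) k)) j =
      polarRecon (fun l => q (l + 1)) m (polarRadius R 1) j := by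
  simp only [polarRecon, ← polarRadius_add, ← polarAngle_add, add_comm]

/-- Within a pair, `cos ψ cos θ + sin ψ sin θ = cos (ψ - θ)`. What is left is the same inner product
one level higher, with cosine weights. -/
theorem sum_mul_polarRecon_succ (q : ℕ → ℝ → ℝ) (m : ℕ) (R : ℕ → ℝ) :
    ∑ i ∈ Finset.range (2 ^ (m + 1)), R i * polarRecon q (m + 1) R i =
      ∑ j ∈ Finset.range (2 ^ m),
        polarRadius R 1 j * polarRecon (fun l => q (l + 1)) m (polarRadius R 1) j *
          Real.cos (polarAngle R 0 j - q 0 (polarAngle R 0 j)) := by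
  rw [pow_succ', Finset.sum_range_two_mul]
  refine Finset.sum_congr rfl fun j _ => ?_
  have h1 : R (2 * j) = polarRadius R 1 j * Real.cos (polarAngle R 0 j) :=
    (polarRadius_mul_cos R 0 j).symm
  have h2 : R (2 * j + 1) = polarRadius R 1 j * Real.sin (polarAngle R 0 j) :=
    (polarRadius_mul_sin R 0 j).symm
  rw [polarRecon, polarRecon, polarInv_two_mul, polarInv_two_mul_add_one, h1, h2,
    polarRecon_succ_aux, Real.cos_sub]
  ring

theorem measurable_polarInv {α : Type*} [MeasurableSpace α] (m : ℕ) {r : α → ℝ}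
    {φ : ℕ → ℕ → α → ℝ} (hr : Measurable r) (hφ : ∀ l k, Measurable (φ l k)) (i : ℕ) :
    Measurable fun a => polarInv m (r a) (fun l k => φ l k a) i := by
  induction m generalizing φ i with
  | zero => exact hr
  | succ m ih =>
    simp only [polarInv]
    refine (ih (φ := fun l => φ (l + 1)) (fun l k => hφ _ _) _).mul ?_
    split_ifs
    · exact (hφ _ _).cos
    · exact (hφ _ _).sin

theorem measurable_polarRecon {q : ℕ → ℝ → ℝ} (hq : ∀ l, Measurable (q l)) (m i : ℕ) :
    Measurable fun R => polarRecon q m R i :=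
  measurable_polarInv m (measurable_polarRadius m 0)
    (φ := fun l k R => q l (polarAngle R l k))
    (fun l k => (hq l).comp (measurable_polarAngle l k)) i

/-! ### Independence and Gaussian coordinates -/

theorem ProbabilityTheory.IndepFun.prodMk_assoc {Ω α β γ : Type*} [MeasurableSpace Ω]
    [MeasurableSpace α] [MeasurableSpace β] [MeasurableSpace γ] {μ : Measure Ω}
    [IsProbabilityMeasure μ] {A : Ω → α} {B : Ω → β} {C : Ω → γ} (hA : Measurable A)
    (hB : Measurable B) (hC : Measurable C) (h : IndepFun A B μ)
    (h' : IndepFun (fun ω => (A ω, B ω)) C μ) : IndepFun A (fun ω => (B ω, C ω)) μ := by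
  have hBC : IndepFun B C μ := h'.comp measurable_snd measurable_id
  have := Measure.isProbabilityMeasure_map (μ := μ) hA.aemeasurable
  have := Measure.isProbabilityMeasure_map (μ := μ) hB.aemeasurable
  have := Measure.isProbabilityMeasure_map (μ := μ) hC.aemeasurable
  rw [indepFun_iff_map_prod_eq_prod_map_map (by fun_prop) (by fun_prop)] at h h' hBC ⊢
  rw [hBC, ← Measure.prodAssoc_prod, ← h, ← h', Measure.map_map (by fun_prop) (by fun_prop)]
  rfl

section Coordinates

variable {ι κ : Type*} [Fintype ι] [Fintype κ]

theorem map_ofLp_stdGaussian :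
    (stdGaussian (EuclideanSpace ℝ ι)).map (fun y i => y i) =
      Measure.pi fun _ => gaussianReal 0 1 := by
  rw [← map_pi_eq_stdGaussian, Measure.map_map (by fun_prop) (by fun_prop)]
  exact Measure.map_id

theorem map_apply_stdGaussian (i : ι) :
    (stdGaussian (EuclideanSpace ℝ ι)).map (fun y => y i) = gaussianReal 0 1 := by
  have h := (measurePreserving_eval (fun _ : ι => gaussianReal 0 1) i).map_eq
  rwa [← map_ofLp_stdGaussian, Measure.map_map (by fun_prop) (by fun_prop)] at h

theorem iIndepFun_apply_stdGaussian :
    iIndepFun (fun i (y : EuclideanSpace ℝ ι) => y i) (stdGaussian (EuclideanSpace ℝ ι)) := by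
  rw [iIndepFun_iff_map_fun_eq_pi_map (fun i => by fun_prop)]
  simp_rw [map_apply_stdGaussian]
  exact map_ofLp_stdGaussian

theorem map_comp_stdGaussian {f : κ → ι} (hf : Function.Injective f) :
    (stdGaussian (EuclideanSpace ℝ ι)).map (fun y => WithLp.toLp 2 fun k => y (f k)) =
      stdGaussian (EuclideanSpace ℝ κ) := by
  have h := (iIndepFun_apply_stdGaussian (ι := ι)).precomp hf
  rw [iIndepFun_iff_map_fun_eq_pi_map (fun i => by fun_prop)] at h
  simp_rw [map_apply_stdGaussian] at h
  rw [← map_pi_eq_stdGaussian (ι := κ), ← h, Measure.map_map (by fun_prop) (by fun_prop)]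
  rfl

end Coordinates

theorem ProbabilityTheory.IndepFun.of_map {Ω Ω' α β : Type*} [MeasurableSpace Ω]
    [MeasurableSpace Ω'] [MeasurableSpace α] [MeasurableSpace β] {μ : Measure Ω} {T : Ω → Ω'}
    (hT : Measurable T) {f : Ω' → α} {g : Ω' → β} (hf : Measurable f) (hg : Measurable g)
    (h : IndepFun f g (μ.map T)) : IndepFun (fun ω => f (T ω)) (fun ω => g (T ω)) μ := by
  rw [indepFun_iff_measure_inter_preimage_eq_mul] at h ⊢
  intro s t hs ht
  have := h s t hs ht
  rwa [Measure.map_apply hT ((hf hs).inter (hg ht)), Measure.map_apply hT (hf hs),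
    Measure.map_apply hT (hg ht)] at this

theorem polarAngle_congr {y z : ℕ → ℝ} {ℓ j : ℕ}
    (h : ∀ i < 2 ^ (ℓ + 1), y (j * 2 ^ (ℓ + 1) + i) = z (j * 2 ^ (ℓ + 1) + i)) :
    polarAngle y ℓ j = polarAngle z ℓ j := by
  have e : ∀ i, j * 2 ^ (ℓ + 1) + i = 2 * j * 2 ^ ℓ + i := fun i => by ring
  simp only [e] at h
  rw [polarAngle, polarAngle, polarRadius_congr (z := z) (j := 2 * j),
    polarRadius_congr (z := z) (j := 2 * j + 1)]
  · intro i hi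
    have := h (2 ^ ℓ + i) (by rw [pow_succ]; omega)
    rw [add_mul, one_mul, add_assoc]
    exact this
  · intro i hi
    exact h i (by rw [pow_succ]; omega)

/-! ### Blocks of coordinates and independence of angles from radii -/

section Blocks

variable {t : ℕ}

theorem measurable_coords :
    Measurable fun y : EuclideanSpace ℝ (Fin (2 ^ t)) => coords y := by
  refine measurable_pi_lambda _ fun i => ?_
  unfold coords
  split_ifs <;> fun_prop

theorem sum_coords_sq (y : EuclideanSpace ℝ (Fin (2 ^ t))) :
    ∑ i ∈ Finset.range (2 ^ t), coords y i ^ 2 = ‖y‖ ^ 2 := by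
  rw [Finset.sum_range, EuclideanSpace.real_norm_sq_eq]
  simp [coords]

theorem polarRadius_coords_sq (y : EuclideanSpace ℝ (Fin (2 ^ t))) :
    polarRadius (coords y) t 0 ^ 2 = ‖y‖ ^ 2 := by
  rw [polarRadius_sq, ← sum_coords_sq]
  simp

theorem polarRadius_coords (ht : t ≠ 0) (y : EuclideanSpace ℝ (Fin (2 ^ t))) :
    polarRadius (coords y) t 0 = ‖y‖ := by
  rw [← sq_eq_sq₀ (polarRadius_nonneg _ ht _) (norm_nonneg y), polarRadius_coords_sq]

theorem coords_smul (c : ℝ) (y : EuclideanSpace ℝ (Fin (2 ^ t))) :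
    coords (c • y) = fun i => c * coords y i := by
  funext i
  unfold coords
  split_ifs <;> simp

/-- The `j`-th block of `2 ^ m` consecutive coordinates. -/
def coordBlock (m j : ℕ) (h : (j + 1) * 2 ^ m ≤ 2 ^ t) (y : EuclideanSpace ℝ (Fin (2 ^ t))) :
    EuclideanSpace ℝ (Fin (2 ^ m)) :=
  WithLp.toLp 2 fun i => y ⟨j * 2 ^ m + i, by have := i.2; rw [add_mul, one_mul] at h; omega⟩

theorem measurable_coordBlock (m j : ℕ) (h : (j + 1) * 2 ^ m ≤ 2 ^ t) :
    Measurable (coordBlock m j h) := by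
  unfold coordBlock
  fun_prop

theorem map_coordBlock (m j : ℕ) (h : (j + 1) * 2 ^ m ≤ 2 ^ t) :
    (stdGaussian (EuclideanSpace ℝ (Fin (2 ^ t)))).map (coordBlock m j h) =
      stdGaussian (EuclideanSpace ℝ (Fin (2 ^ m))) := by
  refine map_comp_stdGaussian (f := fun i : Fin (2 ^ m) =>
    (⟨j * 2 ^ m + i, by have := i.2; rw [add_mul, one_mul] at h; omega⟩ : Fin (2 ^ t))) ?_
  intro a b hab
  simpa [Fin.ext_iff] using hab

theorem coords_coordBlock (m j : ℕ) (h : (j + 1) * 2 ^ m ≤ 2 ^ t)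
    (y : EuclideanSpace ℝ (Fin (2 ^ t))) {i : ℕ} (hi : i < 2 ^ m) :
    coords (coordBlock m j h y) i = coords y (j * 2 ^ m + i) := by
  have : j * 2 ^ m + i < 2 ^ t := by rw [add_mul, one_mul] at h; omega
  simp [coords, coordBlock, hi, this]

theorem polarAngle_coordBlock (ℓ j : ℕ) (h : (j + 1) * 2 ^ (ℓ + 1) ≤ 2 ^ t)
    (y : EuclideanSpace ℝ (Fin (2 ^ t))) :
    polarAngle (coords (coordBlock (ℓ + 1) j h y)) ℓ 0 = polarAngle (coords y) ℓ j := by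
  rw [← polarAngle_shift (coords y)]
  refine polarAngle_congr fun i hi => ?_
  simpa using coords_coordBlock _ _ h y hi

theorem polarRadius_coordBlock (m j : ℕ) (h : (j + 1) * 2 ^ m ≤ 2 ^ t)
    (y : EuclideanSpace ℝ (Fin (2 ^ t))) :
    polarRadius (coords (coordBlock m j h y)) m 0 = polarRadius (coords y) m j := by
  have e := polarRadius_shift (coords y) m j 0
  rw [add_zero] at e
  rw [← e]
  refine polarRadius_congr fun i hi => ?_
  simpa using coords_coordBlock _ _ h y hi

theorem measurable_polarAngle_coords (ℓ j : ℕ) :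
    Measurable fun y : EuclideanSpace ℝ (Fin (2 ^ t)) => polarAngle (coords y) ℓ j :=
  (measurable_polarAngle ℓ j).comp measurable_coords

theorem measurable_polarRadius_coords (ℓ j : ℕ) :
    Measurable fun y : EuclideanSpace ℝ (Fin (2 ^ t)) => polarRadius (coords y) ℓ j :=
  (measurable_polarRadius ℓ j).comp measurable_coords

theorem map_polarAngle_coords (ℓ j : ℕ) (h : (j + 1) * 2 ^ (ℓ + 1) ≤ 2 ^ t) :
    (stdGaussian (EuclideanSpace ℝ (Fin (2 ^ t)))).map (fun y => polarAngle (coords y) ℓ j) =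
      angleLaw ℓ := by
  rw [angleLaw, ← map_coordBlock _ _ h, Measure.map_map (measurable_polarAngle_coords ℓ 0)
    (measurable_coordBlock _ _ h)]
  congr 1
  funext y
  exact (polarAngle_coordBlock ℓ j h y).symm

theorem indepFun_polarAngle_norm (ℓ : ℕ) :
    IndepFun (fun y => polarAngle (coords y) ℓ 0) (fun y => ‖y‖)
      (stdGaussian (EuclideanSpace ℝ (Fin (2 ^ (ℓ + 1))))) := by
  refine indepFun_norm_stdGaussian (measurable_polarAngle_coords ℓ 0) fun c hc x => ?_
  rw [coords_smul, polarAngle_mul hc]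

/-- The sequence with the values `z` on `S` and `0` elsewhere. -/
def extendCoords (S : Finset (Fin (2 ^ t))) (z : S → ℝ) (i : ℕ) : ℝ :=
  if h : ∃ h : i < 2 ^ t, (⟨i, h⟩ : Fin (2 ^ t)) ∈ S then z ⟨⟨i, h.1⟩, h.2⟩ else 0

theorem measurable_extendCoords (S : Finset (Fin (2 ^ t))) : Measurable (extendCoords S) := by
  refine measurable_pi_lambda _ fun i => ?_
  unfold extendCoords
  split_ifs <;> fun_prop

theorem extendCoords_eq (S : Finset (Fin (2 ^ t))) (y : EuclideanSpace ℝ (Fin (2 ^ t))) {i : ℕ}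
    (hi : ∀ h : i < 2 ^ t, (⟨i, h⟩ : Fin (2 ^ t)) ∈ S) :
    extendCoords S (fun k => y k) i = coords y i := by
  unfold extendCoords coords
  by_cases h : i < 2 ^ t
  · simp [h, hi h]
  · simp [h]

/-- An angle is independent of the radii of its level, the radius of its own pair included. -/
theorem indepFun_polarAngle_polarRadius (ℓ j : ℕ) (h : (j + 1) * 2 ^ (ℓ + 1) ≤ 2 ^ t) :
    IndepFun (fun y => polarAngle (coords y) ℓ j) (fun y => polarRadius (coords y) (ℓ + 1))
      (stdGaussian (EuclideanSpace ℝ (Fin (2 ^ t)))) := by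
  -- The block of coordinates that determines the `j`-th angle; the other radii of the level depend
  -- on its complement only.
  set S : Finset (Fin (2 ^ t)) := Finset.univ.filter fun i => (i : ℕ) / 2 ^ (ℓ + 1) = j with hS
  have hdiv : ∀ k i : ℕ, i < 2 ^ (ℓ + 1) → (k * 2 ^ (ℓ + 1) + i) / 2 ^ (ℓ + 1) = k := by
    intro k i hi
    rw [mul_comm, Nat.mul_add_div (by positivity), Nat.div_eq_of_lt hi, add_zero]
  have hST := (iIndepFun_apply_stdGaussian (ι := Fin (2 ^ t))).indepFun_finset S Sᶜ
    disjoint_compl_right (fun i => by fun_prop)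
  have hext : ∀ (y : EuclideanSpace ℝ (Fin (2 ^ t))) (i : ℕ), i < 2 ^ (ℓ + 1) →
      extendCoords S (fun k => y k) (j * 2 ^ (ℓ + 1) + i) = coords y (j * 2 ^ (ℓ + 1) + i) :=
    fun y i hi => extendCoords_eq S y fun _ => by simp [hS, hdiv j i hi]
  have hext' : ∀ (y : EuclideanSpace ℝ (Fin (2 ^ t))) (k i : ℕ), k ≠ j → i < 2 ^ (ℓ + 1) →
      extendCoords Sᶜ (fun k => y k) (k * 2 ^ (ℓ + 1) + i) = coords y (k * 2 ^ (ℓ + 1) + i) :=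
    fun y k i hk hi => extendCoords_eq Sᶜ y fun _ => by simp [hS, hdiv k i hi, hk]
  have hm1 : Measurable fun z : S → ℝ => (polarAngle (extendCoords S z) ℓ j,
      polarRadius (extendCoords S z) (ℓ + 1) j) :=
    ((measurable_polarAngle ℓ j).comp (measurable_extendCoords S)).prodMk
      ((measurable_polarRadius (ℓ + 1) j).comp (measurable_extendCoords S))
  have hm2 : Measurable fun z : (Sᶜ : Finset (Fin (2 ^ t))) → ℝ =>
      (fun k => polarRadius (extendCoords Sᶜ z) (ℓ + 1) k) :=
    measurable_pi_lambda _ fun k =>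
      (measurable_polarRadius (ℓ + 1) k).comp (measurable_extendCoords Sᶜ)
  have hcomp := hST.comp hm1 hm2
  -- Inside the block, the angle depends on the direction and the radius is the norm.
  have h12 : IndepFun (fun y => polarAngle (coords y) ℓ j)
      (fun y => polarRadius (coords y) (ℓ + 1) j)
      (stdGaussian (EuclideanSpace ℝ (Fin (2 ^ t)))) := by
    have := indepFun_polarAngle_norm ℓ
    rw [← map_coordBlock _ _ h] at this
    have := this.of_map (measurable_coordBlock _ _ h) (measurable_polarAngle_coords ℓ 0)
      measurable_norm
    simpa only [polarAngle_coordBlock, ← polarRadius_coords (Nat.succ_ne_zero ℓ),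
      polarRadius_coordBlock] using this
  have hrest : IndepFun
      (fun y => (polarAngle (coords y) ℓ j, polarRadius (coords y) (ℓ + 1) j))
      (fun (y : EuclideanSpace ℝ (Fin (2 ^ t))) k =>
        polarRadius (extendCoords Sᶜ fun i => y i) (ℓ + 1) k)
      (stdGaussian (EuclideanSpace ℝ (Fin (2 ^ t)))) := by
    convert! hcomp using 1
    funext y
    exact Prod.ext (polarAngle_congr (hext y)).symm (polarRadius_congr (hext y)).symm
  have hres := h12.prodMk_assoc (measurable_polarAngle_coords ℓ j)
    (measurable_polarRadius_coords (ℓ + 1) j) (hm2.comp (by fun_prop)) hrest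
  -- The whole sequence of radii is recovered by inserting the block's own radius at place `j` among
  -- those computed from the complement.
  have hupd : Measurable fun p : ℝ × (ℕ → ℝ) => Function.update p.2 j p.1 := by
    refine measurable_pi_lambda _ fun k => ?_
    by_cases hk : k = j
    · subst hk; simpa using measurable_fst
    · simp only [Function.update_of_ne hk]; fun_prop
  convert! hres.comp measurable_id hupd using 1
  funext y k
  by_cases hk : k = j
  · subst hk; simp
  · simp only [Function.comp_apply, Function.update_of_ne hk]
    exact (polarRadius_congr (hext' y k · hk)).symm

end Blocks

instance (ℓ : ℕ) : IsProbabilityMeasure (angleLaw ℓ) :=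
  Measure.isProbabilityMeasure_map (measurable_polarAngle_coords ℓ 0).aemeasurable

theorem ae_mem_angleRange (ℓ : ℕ) : ∀ᵐ ψ ∂(angleLaw ℓ), ψ ∈ angleRange ℓ := by
  have hm : MeasurableSet (angleRange ℓ) := by
    unfold angleRange; split_ifs; exacts [measurableSet_Ico, measurableSet_Icc]
  exact (ae_map_iff (p := fun ψ => ψ ∈ angleRange ℓ)
    (measurable_polarAngle_coords ℓ 0).aemeasurable hm).2 <| ae_of_all _ fun y => polarAngle_mem_angleRange _ _ _

theorem angleRange_subset (ℓ : ℕ) : angleRange ℓ ⊆ Set.Icc 0 (2 * Real.pi) := by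
  have := Real.pi_pos
  unfold angleRange
  split_ifs
  · exact Set.Ico_subset_Icc_self
  · exact Set.Icc_subset_Icc_right (by linarith)

/-! ### Fourth moments and concentration of the upper angles -/

section Moments

theorem memLp_sq_gaussianReal : MemLp (fun x : ℝ => x ^ 2) 2 (gaussianReal 0 1) := by
  have h := (memLp_id_gaussianReal (μ := 0) (v := 1) 4).norm_rpow_div 2
  refine (memLp_congr_ae (ae_of_all _ fun x => ?_)).1
    (h.mono_exponent (p := 2) (le_of_eq ?_))
  · simp
  · rw [ENNReal.eq_div_iff (by simp) (by simp)]
    norm_num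

theorem integral_sq_gaussianReal : ∫ x, x ^ 2 ∂(gaussianReal 0 1) = 1 := by
  have h := variance_id_gaussianReal (μ := 0) (v := 1)
  rwa [variance_of_integral_eq_zero aemeasurable_id integral_id_gaussianReal] at h

/-- The fourth moment is controlled by `x⁴ / 4! ≤ exp |x| ≤ exp x + exp (-x)`, and `48 √e ≤ 48 · 5/3
= 80`. The bound is crude, but only an absolute constant is needed. -/
theorem variance_sq_gaussianReal_le : Var[fun x => x ^ 2; gaussianReal 0 1] ≤ 80 := by
  refine (variance_le_expectation_sq (by fun_prop)).trans ?_
  have hi : ∀ c : ℝ, Integrable (fun x => Real.exp (c * x)) (gaussianReal 0 1) :=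
    fun c => integrable_exp_mul_gaussianReal c
  have hmgf : ∀ c : ℝ, ∫ x, Real.exp (c * x) ∂(gaussianReal 0 1) = Real.exp (c ^ 2 / 2) := by
    intro c
    have := congrFun (mgf_fun_id_gaussianReal (μ := 0) (v := 1)) c
    simpa [mgf] using this
  have hle : ∀ x : ℝ, (x ^ 2) ^ 2 ≤ 24 * (Real.exp (1 * x) + Real.exp (-1 * x)) := by
    intro x
    have h1 := Real.pow_div_factorial_le_exp |x| (abs_nonneg x) 4
    have h2 : Real.exp |x| ≤ Real.exp (1 * x) + Real.exp (-1 * x) := by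
      rcases abs_cases x with ⟨h, _⟩ | ⟨h, _⟩ <;> rw [h]
      · simpa using (Real.exp_pos _).le
      · simpa using (Real.exp_pos _).le
    have h3 : |x| ^ 4 = (x ^ 2) ^ 2 := by rw [← sq_abs x]; ring
    norm_num [Nat.factorial] at h1
    nlinarith
  have hint := ((hi 1).add (hi (-1))).const_mul 24
  calc ∫ x, ((fun x : ℝ => x ^ 2) ^ 2) x ∂(gaussianReal 0 1)
      ≤ ∫ x, 24 * (Real.exp (1 * x) + Real.exp (-1 * x)) ∂(gaussianReal 0 1) :=
        integral_mono_of_nonneg (ae_of_all _ fun x => by simp only [Pi.pow_apply]; positivity) hint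
          (ae_of_all _ hle)
    _ = 48 * Real.exp (1 / 2) := by
        rw [integral_const_mul, integral_add (hi 1) (hi (-1)), hmgf, hmgf]
        norm_num
        ring
    _ ≤ 80 := by
        have h1 : Real.exp (1 / 2) ^ 2 ≤ (5 / 3) ^ 2 := by
          rw [← Real.exp_nat_mul]
          norm_num
          linarith [Real.exp_one_lt_d9]
        have := abs_le_of_sq_le_sq' h1 (by norm_num)
        linarith [this.2]

/-- Second moment as variance plus squared mean, the variance being additive over independent
coordinates. -/
theorem integral_sum_mul_sq_sq {ι : Type*} [Fintype ι] (s : ι → ℝ) :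
    ∫ y, (∑ i, s i * y i ^ 2) ^ 2 ∂(stdGaussian (EuclideanSpace ℝ ι)) =
      (∑ i, s i ^ 2) * Var[fun x => x ^ 2; gaussianReal 0 1] + (∑ i, s i) ^ 2 := by
  set ν := Measure.pi fun _ : ι => gaussianReal 0 1
  have hL : ∀ i, MemLp (fun x : ℝ => s i * x ^ 2) 2 (gaussianReal 0 1) :=
    fun i => memLp_sq_gaussianReal.const_mul (s i)
  have hL' : ∀ i, MemLp (fun x : ι → ℝ => s i * x i ^ 2) 2 ν := fun i =>
    (hL i).comp_measurePreserving (measurePreserving_eval (fun _ : ι => gaussianReal 0 1) i)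
  have hV : Var[∑ i, fun x : ι → ℝ => s i * x i ^ 2; ν] =
      (∑ i, s i ^ 2) * Var[fun x => x ^ 2; gaussianReal 0 1] := by
    rw [variance_sum_pi (μ := fun _ : ι => gaussianReal 0 1) (X := fun i x => s i * x ^ 2) hL,
      Finset.sum_mul]
    exact Finset.sum_congr rfl fun i _ => variance_const_mul _ _ _
  have hE : ∫ x, (∑ i, fun x : ι → ℝ => s i * x i ^ 2) x ∂ν = ∑ i, s i := by
    simp only [Finset.sum_apply]
    rw [integral_finsetSum _ fun i _ => (hL' i).integrable one_le_two]
    refine Finset.sum_congr rfl fun i _ => ?_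
    have h := integral_comp_eval (μ := fun _ : ι => gaussianReal 0 1) (i := i)
      (f := fun x : ℝ => s i * x ^ 2) (by fun_prop)
    rw [h, integral_const_mul, integral_sq_gaussianReal, mul_one]
  rw [← hV, ← hE, variance_eq_sub (memLp_finsetSum' _ fun i _ => hL' i), sub_add_cancel]
  simp only [Pi.pow_apply, Finset.sum_apply, ν]
  rw [← map_ofLp_stdGaussian, integral_map (by fun_prop)
    (Continuous.aestronglyMeasurable (by fun_prop))]

/-- With signs `+1` on the first half of the block and `-1` on the second, the signed sum of squares
is `‖y‖² cos 2ψ`. As `ψ` is independent of `‖y‖`, the mean of `cos² 2ψ` is a ratio of two second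
moments, namely `V / (V + N)` with `N = 2 ^ (ℓ + 1)` and `V ≤ 80`. -/
theorem integral_cos_two_mul_sq_angleLaw_le (ℓ : ℕ) :
    ∫ ψ, Real.cos (2 * ψ) ^ 2 ∂(angleLaw ℓ) ≤ 40 / 2 ^ ℓ := by
  set V := Var[fun x => x ^ 2; gaussianReal 0 1] with hVdef
  have hV0 : 0 ≤ V := variance_nonneg _ _
  set s : Fin (2 ^ (ℓ + 1)) → ℝ := fun i => if (i : ℕ) < 2 ^ ℓ then 1 else -1 with hs
  have hs2 : ∀ i, s i ^ 2 = 1 := fun i => by simp only [hs]; split_ifs <;> norm_num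
  have hsplit : ∀ f : ℕ → ℝ, ∑ i : Fin (2 ^ (ℓ + 1)), s i * f i =
      ∑ i ∈ Finset.range (2 ^ ℓ), f i - ∑ i ∈ Finset.range (2 ^ ℓ), f (2 ^ ℓ + i) := by
    intro f
    have : ∑ i : Fin (2 ^ (ℓ + 1)), s i * f i =
        ∑ i ∈ Finset.range (2 ^ (ℓ + 1)), (if i < 2 ^ ℓ then (1 : ℝ) else -1) * f i := by
      rw [Finset.sum_range]
    rw [this, pow_succ, mul_two, Finset.sum_range_add, sub_eq_add_neg, ← Finset.sum_neg_distrib]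
    congr 1
    · exact Finset.sum_congr rfl fun i hi => by simp [Finset.mem_range.1 hi]
    · exact Finset.sum_congr rfl fun i hi => by simp
  have hs1 : ∑ i, s i = 0 := by simpa using hsplit fun _ => 1
  have h1 := integral_sum_mul_sq_sq s
  have h2 := integral_sum_mul_sq_sq fun _ : Fin (2 ^ (ℓ + 1)) => (1 : ℝ)
  simp only [hs2, hs1, one_mul, ← EuclideanSpace.real_norm_sq_eq, one_pow, Finset.sum_const,
    Finset.card_univ, Fintype.card_fin, nsmul_eq_mul, mul_one] at h1 h2
  push_cast at h1 h2
  have hpt : ∀ y : EuclideanSpace ℝ (Fin (2 ^ (ℓ + 1))), (∑ i, s i * y i ^ 2) ^ 2 =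
      Real.cos (2 * polarAngle (coords y) ℓ 0) ^ 2 * (‖y‖ ^ 2) ^ 2 := by
    intro y
    have e : ∑ i, s i * y i ^ 2 = polarRadius (coords y) ℓ 0 ^ 2 - polarRadius (coords y) ℓ 1 ^ 2 := by
      rw [polarRadius_sq, polarRadius_sq]
      have := hsplit fun i => coords y i ^ 2
      simpa [coords] using this
    have hc := polarRadius_mul_cos (coords y) ℓ 0
    have hsn := polarRadius_mul_sin (coords y) ℓ 0
    rw [polarRadius_coords (Nat.succ_ne_zero ℓ)] at hc hsn
    rw [e, Real.cos_two_mul', ← mul_pow]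
    simp only [mul_zero, zero_add] at hc hsn
    rw [← hc, ← hsn]
    ring
  have hind := (indepFun_polarAngle_norm ℓ).integral_fun_comp_mul_comp
    (f := fun ψ => Real.cos (2 * ψ) ^ 2) (g := fun r => (r ^ 2) ^ 2)
    (measurable_polarAngle_coords ℓ 0).aemeasurable measurable_norm.aemeasurable
    (by fun_prop) (by fun_prop)
  simp_rw [hpt] at h1
  rw [hind, h2] at h1
  have hmap : ∫ ψ, Real.cos (2 * ψ) ^ 2 ∂(angleLaw ℓ) = ∫ y, Real.cos
      (2 * polarAngle (coords y) ℓ 0) ^ 2 ∂(stdGaussian (EuclideanSpace ℝ (Fin (2 ^ (ℓ + 1))))) := by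
    rw [angleLaw, integral_map (measurable_polarAngle_coords ℓ 0).aemeasurable (by fun_prop)]
  rw [hmap]
  set c := ∫ y, Real.cos
      (2 * polarAngle (coords y) ℓ 0) ^ 2 ∂(stdGaussian (EuclideanSpace ℝ (Fin (2 ^ (ℓ + 1)))))
  have hc0 : 0 ≤ c := integral_nonneg fun _ => by positivity
  have hV80 : V ≤ 80 := variance_sq_gaussianReal_le
  have hN : (0 : ℝ) < 2 ^ ℓ := by positivity
  rw [le_div_iff₀ hN]
  have hkey : c * (V + 2 ^ (ℓ + 1)) = V := by
    have hN' : (2 : ℝ) ^ (ℓ + 1) ≠ 0 := by positivity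
    apply mul_left_cancel₀ hN'
    rw [← hVdef] at h1
    linear_combination h1
  rw [pow_succ] at hkey
  nlinarith [mul_nonneg hc0 hV0]

end Moments

/-! ### Nearest-centroid quantizers -/

section NearestCentroid

variable {b : ℕ} (θ : Fin (2 ^ b) → ℝ)

theorem quantIndex_eq_iff (ψ : ℝ) (k : Fin (2 ^ b)) :
    quantIndex θ ψ = k ↔ (∀ k', |θ k - ψ| ≤ |θ k' - ψ|) ∧ ∀ k' < k, |θ k - ψ| < |θ k' - ψ| := by
  have hmem := Finset.min'_mem _ (exists_nearest θ ψ)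
  rw [Finset.mem_filter] at hmem
  constructor
  · rintro rfl
    refine ⟨hmem.2, fun k' hk' => ?_⟩
    by_contra! h
    refine absurd (Finset.min'_le _ k' ?_) (not_le.2 hk')
    exact Finset.mem_filter.2 ⟨Finset.mem_univ _, fun k'' => h.trans (hmem.2 k'')⟩
  · rintro ⟨h1, h2⟩
    refine le_antisymm (Finset.min'_le _ _ (Finset.mem_filter.2 ⟨Finset.mem_univ _, h1⟩)) ?_
    by_contra! h
    exact absurd (h2 _ h) (not_lt.2 (hmem.2 k))

theorem abs_centroid_quantIndex_le (ψ : ℝ) (k : Fin (2 ^ b)) :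
    |θ (quantIndex θ ψ) - ψ| ≤ |θ k - ψ| :=
  ((quantIndex_eq_iff θ ψ _).1 rfl).1 k

theorem measurable_quantIndex : Measurable (quantIndex θ) := by
  refine measurable_to_countable' fun k => ?_
  have : quantIndex θ ⁻¹' {k} = (⋂ k', {ψ | |θ k - ψ| ≤ |θ k' - ψ|}) ∩
      ⋂ k', ⋂ (_ : k' < k), {ψ | |θ k - ψ| < |θ k' - ψ|} := by
    ext ψ
    simp [quantIndex_eq_iff]
  rw [this]
  exact (MeasurableSet.iInter fun k' => measurableSet_le (by fun_prop) (by fun_prop)).inter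
    (MeasurableSet.iInter fun k' => MeasurableSet.iInter fun _ =>
      measurableSet_lt (by fun_prop) (by fun_prop))

/-- The squared distance to the nearest centroid. -/
noncomputable def nearestErr (ψ : ℝ) : ℝ := |ψ - θ (quantIndex θ ψ)| ^ 2

theorem nearestErr_nonneg (ψ : ℝ) : 0 ≤ nearestErr θ ψ := sq_nonneg _

theorem nearestErr_le (ψ : ℝ) (k : Fin (2 ^ b)) : nearestErr θ ψ ≤ |ψ - θ k| ^ 2 := by
  unfold nearestErr
  rw [abs_sub_comm, abs_sub_comm ψ]
  refine pow_le_pow_left₀ (abs_nonneg _) ?_ 2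
  exact abs_centroid_quantIndex_le θ ψ k

theorem measurable_centroid_quantIndex : Measurable fun ψ => θ (quantIndex θ ψ) :=
  (measurable_of_countable θ).comp (measurable_quantIndex θ)

theorem measurable_nearestErr : Measurable (nearestErr θ) :=
  ((measurable_id.sub (measurable_centroid_quantIndex θ)).abs).pow_const 2

/-- The nearest index jumps as the centroids move, but the minimum does not; this form gives
continuity in `θ`. -/
theorem nearestErr_eq_inf' (ψ : ℝ) :
    nearestErr θ ψ = Finset.univ.inf' Finset.univ_nonempty fun k => |ψ - θ k| ^ 2 :=
  le_antisymm (Finset.le_inf' _ _ fun k _ => nearestErr_le θ ψ k)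
    (Finset.inf'_le (fun k => |ψ - θ k| ^ 2) (Finset.mem_univ (quantIndex θ ψ)))

theorem continuous_nearestErr (ψ : ℝ) :
    Continuous fun θ : Fin (2 ^ b) → ℝ => nearestErr θ ψ := by
  simp_rw [nearestErr_eq_inf']
  exact Continuous.finset_inf'_apply _ fun k _ => by fun_prop

/-- After squaring, `ψ²` cancels and the comparison is affine in `ψ`. Hence the nearest-centroid
cells are intersections of half-lines (possibly empty or full), that is, intervals. -/
theorem abs_sub_le_iff_mul_le (a c ψ : ℝ) :
    |a - ψ| ≤ |c - ψ| ↔ 2 * (a - c) * ψ ≥ a ^ 2 - c ^ 2 := by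
  rw [← sq_le_sq]
  constructor <;> intro h <;> linarith

theorem ordConnected_setOf_affine_nonneg {p : ℝ → Prop} {m n : ℝ}
    (h : (∀ ψ, p ψ ↔ m ≤ n * ψ) ∨ ∀ ψ, p ψ ↔ m < n * ψ) : {ψ | p ψ}.OrdConnected := by
  refine ⟨fun x hx y hy z hz => ?_⟩
  have hxy : n * x ≤ n * z ∨ n * y ≤ n * z := by
    rcases le_total 0 n with hn | hn
    · exact Or.inl (mul_le_mul_of_nonneg_left hz.1 hn)
    · exact Or.inr (mul_le_mul_of_nonpos_left hz.2 hn)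
  rcases h with h | h <;> simp only [Set.mem_ofPred_eq, h] at hx hy ⊢ <;>
    rcases hxy with h' | h' <;> linarith

theorem ordConnected_quantIndex_eq (k : Fin (2 ^ b)) :
    {ψ | quantIndex θ ψ = k}.OrdConnected := by
  have : {ψ | quantIndex θ ψ = k} = (⋂ k', {ψ | |θ k - ψ| ≤ |θ k' - ψ|}) ∩
      ⋂ k', ⋂ (_ : k' < k), {ψ | |θ k - ψ| < |θ k' - ψ|} := by
    ext ψ
    simp [quantIndex_eq_iff]
  rw [this]
  refine (Set.ordConnected_iInter fun k' => ?_).inter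
    (Set.ordConnected_iInter fun k' => Set.ordConnected_iInter fun _ => ?_)
  · exact ordConnected_setOf_affine_nonneg
      (Or.inl fun ψ => abs_sub_le_iff_mul_le (θ k) (θ k') ψ)
  · refine ordConnected_setOf_affine_nonneg
      (m := θ k ^ 2 - θ k' ^ 2) (n := 2 * (θ k - θ k')) (Or.inr fun ψ => ?_)
    rw [← not_le, abs_sub_le_iff_mul_le, ge_iff_le, not_le]
    constructor <;> intro h <;> linarith

/-- The quantizer with given centroids whose cells are the sets of nearest points. -/
def AngleQuantizer.ofCentroids (ℓ : ℕ) : AngleQuantizer b ℓ where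
  cell k := angleRange ℓ ∩ {ψ | quantIndex θ ψ = k}
  centroid := θ
  ordConnected k := by
    refine Set.OrdConnected.inter ?_ (ordConnected_quantIndex_eq θ k)
    unfold angleRange; split_ifs; exacts [Set.ordConnected_Ico, Set.ordConnected_Icc]
  disjoint k k' hk := Set.disjoint_left.2 fun ψ h h' => hk (h.2.symm.trans h'.2)
  iUnion_cell := by
    rw [← Set.inter_iUnion]
    exact Set.inter_eq_left.2 fun ψ _ => Set.mem_iUnion.2 ⟨quantIndex θ ψ, rfl⟩

end NearestCentroid

/-! ### Optimal quantizers and two comparison quantizers -/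

section Cost

variable {b ℓ : ℕ}

theorem AngleQuantizer.sum_indicator_eq (q : AngleQuantizer b ℓ) {ψ : ℝ} {k : Fin (2 ^ b)}
    (hk : ψ ∈ q.cell k) :
    ∑ k, (q.cell k).indicator (fun φ => |φ - q.centroid k| ^ 2) ψ = |ψ - q.centroid k| ^ 2 := by
  rw [Finset.sum_eq_single k]
  · exact Set.indicator_of_mem hk _
  · intro k' _ hk'
    exact Set.indicator_of_notMem (fun h => Set.disjoint_left.1 (q.disjoint hk') h hk) _
  · simp

theorem AngleQuantizer.exists_mem_cell (q : AngleQuantizer b ℓ) {ψ : ℝ} (h : ψ ∈ angleRange ℓ) :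
    ∃ k, ψ ∈ q.cell k := by
  rwa [← q.iUnion_cell, Set.mem_iUnion] at h

theorem AngleQuantizer.integrable_cost (q : AngleQuantizer b ℓ) :
    Integrable (fun ψ => ∑ k, (q.cell k).indicator (fun φ => |φ - q.centroid k| ^ 2) ψ)
      (angleLaw ℓ) := by
  refine integrable_finsetSum _ fun k _ => ?_
  refine Integrable.indicator ?_ (q.ordConnected k).measurableSet
  refine Integrable.of_bound (by fun_prop) ((2 * Real.pi + |q.centroid k|) ^ 2) ?_
  filter_upwards [ae_mem_angleRange ℓ] with ψ hψ
  have h := angleRange_subset ℓ hψ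
  rw [Real.norm_of_nonneg (by positivity)]
  gcongr
  refine (abs_sub _ _).trans ?_
  rw [abs_of_nonneg h.1]
  gcongr
  exact h.2

theorem integrable_nearestErr (θ : Fin (2 ^ b) → ℝ) : Integrable (nearestErr θ) (angleLaw ℓ) := by
  refine ((AngleQuantizer.ofCentroids θ ℓ).integrable_cost).mono'
    (measurable_nearestErr θ).aestronglyMeasurable ?_
  filter_upwards [ae_mem_angleRange ℓ] with ψ hψ
  obtain ⟨k, hk⟩ := (AngleQuantizer.ofCentroids θ ℓ).exists_mem_cell hψ
  rw [Real.norm_of_nonneg (nearestErr_nonneg _ _), AngleQuantizer.sum_indicator_eq _ hk]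
  exact nearestErr_le θ ψ k

/-- The cell containing `ψ` need not carry the nearest centroid. This passes from the cost, defined
by cells, to the encoder, which picks the nearest centroid. -/
theorem AngleQuantizer.integral_nearestErr_le_cost (q : AngleQuantizer b ℓ) :
    ∫ ψ, nearestErr q.centroid ψ ∂(angleLaw ℓ) ≤ q.cost := by
  refine integral_mono_ae (integrable_nearestErr _) q.integrable_cost ?_
  filter_upwards [ae_mem_angleRange ℓ] with ψ hψ
  obtain ⟨k, hk⟩ := q.exists_mem_cell hψ
  rw [q.sum_indicator_eq hk]
  exact nearestErr_le _ ψ k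

theorem AngleQuantizer.cost_ofCentroids (θ : Fin (2 ^ b) → ℝ) :
    (AngleQuantizer.ofCentroids θ ℓ).cost = ∫ ψ, nearestErr θ ψ ∂(angleLaw ℓ) := by
  refine integral_congr_ae ?_
  filter_upwards [ae_mem_angleRange ℓ] with ψ hψ
  exact AngleQuantizer.sum_indicator_eq _ (k := quantIndex θ ψ) ⟨hψ, rfl⟩

/-- Nearest-point cells are best for given centroids, so only the centroids vary. Their error is
continuous on the cube of centroids in `[0, 2π]`, which is compact. -/
theorem AngleQuantizer.exists_isOptimal (b ℓ : ℕ) : ∃ q : AngleQuantizer b ℓ, q.IsOptimal := by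
  have hπ := Real.pi_pos
  set K : Set (Fin (2 ^ b) → ℝ) := Set.pi Set.univ fun _ => Set.Icc 0 (2 * Real.pi) with hK
  have hKc : IsCompact K := isCompact_univ_pi fun _ => isCompact_Icc
  have hKn : K.Nonempty := ⟨fun _ => 0, fun _ _ => ⟨le_rfl, by positivity⟩⟩
  have hcont : ContinuousOn
      (fun θ : Fin (2 ^ b) → ℝ => ∫ ψ, nearestErr θ ψ ∂(angleLaw ℓ)) K := by
    refine continuousOn_of_dominated (bound := fun _ => (2 * Real.pi) ^ 2)
      (fun θ _ => (measurable_nearestErr θ).aestronglyMeasurable) (fun θ hθ => ?_)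
      (integrable_const _) (ae_of_all _ fun ψ => (continuous_nearestErr ψ).continuousOn)
    filter_upwards [ae_mem_angleRange ℓ] with ψ hψ
    have h := angleRange_subset ℓ hψ
    have h' := hθ (quantIndex θ ψ) trivial
    rw [Real.norm_of_nonneg (nearestErr_nonneg _ _), nearestErr]
    gcongr
    rw [abs_le]
    exact ⟨by linarith [h.1, h'.2], by linarith [h.2, h'.1]⟩
  obtain ⟨θ, -, hmin⟩ := hKc.exists_isMinOn hKn hcont
  refine ⟨AngleQuantizer.ofCentroids θ ℓ, fun q => ?_⟩
  rw [AngleQuantizer.cost_ofCentroids]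
  refine le_trans ?_ q.integral_nearestErr_le_cost
  -- Clamping centroids to `[0, 2π]` loses nothing: the clamp is 1-Lipschitz and fixes every angle.
  set χ : Fin (2 ^ b) → ℝ := fun k => max 0 (min (2 * Real.pi) (q.centroid k))
  have hχ : χ ∈ K := fun k _ => ⟨le_max_left _ _, max_le (by positivity) (min_le_left _ _)⟩
  refine le_trans (hmin hχ) (integral_mono_ae (integrable_nearestErr _) (integrable_nearestErr _) ?_)
  filter_upwards [ae_mem_angleRange ℓ] with ψ hψ
  have h := angleRange_subset ℓ hψ
  refine (nearestErr_le χ ψ (quantIndex q.centroid ψ)).trans ?_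
  unfold nearestErr
  refine pow_le_pow_left₀ (abs_nonneg _) ?_ 2
  have e : ψ = max 0 (min (2 * Real.pi) ψ) := by rw [min_eq_right h.2, max_eq_right h.1]
  calc |ψ - χ (quantIndex q.centroid ψ)|
      = |max (min (2 * Real.pi) ψ) 0 - max (min (2 * Real.pi) (q.centroid _)) 0| := by
        rw [max_comm, ← e, max_comm]
    _ ≤ |min (2 * Real.pi) ψ - min (2 * Real.pi) (q.centroid _)| := abs_max_sub_max_le_abs _ _ _
    _ ≤ |ψ - q.centroid _| := by
        rw [min_comm, min_comm (2 * Real.pi)]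
        exact abs_inf_sub_inf_le_abs _ _ _

theorem AngleQuantizer.IsOptimal.integral_nearestErr_le {q : AngleQuantizer b ℓ} (h : q.IsOptimal)
    (θ : Fin (2 ^ b) → ℝ) :
    ∫ ψ, nearestErr q.centroid ψ ∂(angleLaw ℓ) ≤ ∫ ψ, nearestErr θ ψ ∂(angleLaw ℓ) := by
  rw [← AngleQuantizer.cost_ofCentroids θ]
  exact q.integral_nearestErr_le_cost.trans (h _)

theorem integral_nearestErr_uniform_le (b ℓ : ℕ) :
    ∫ ψ, nearestErr (fun k : Fin (2 ^ b) => (k : ℝ) * (2 * Real.pi / 2 ^ b)) ψ ∂(angleLaw ℓ) ≤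
      (2 * Real.pi / 2 ^ b) ^ 2 := by
  have hπ := Real.pi_pos
  set w := 2 * Real.pi / 2 ^ b with hw
  have hw0 : 0 < w := by positivity
  have hwb : w * 2 ^ b = 2 * Real.pi := by rw [hw]; field_simp
  calc _ ≤ ∫ _, w ^ 2 ∂(angleLaw ℓ) := by
        refine integral_mono_ae (integrable_nearestErr _) (integrable_const _) ?_
        filter_upwards [ae_mem_angleRange ℓ] with ψ hψ
        have h0 : 0 ≤ ψ := (angleRange_subset ℓ hψ).1
        -- Strictness keeps the grid index `⌊ψ / w⌋₊` below `2 ^ b`.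
        have h1 : ψ < 2 * Real.pi := by
          unfold angleRange at hψ
          split_ifs at hψ
          · exact hψ.2
          · linarith [hψ.2]
        have hlt : ⌊ψ / w⌋₊ < 2 ^ b := by
          rw [Nat.floor_lt (by positivity), div_lt_iff₀ hw0]
          push_cast
          linarith
        refine (nearestErr_le _ ψ ⟨⌊ψ / w⌋₊, hlt⟩).trans ?_
        gcongr
        have e : ψ = ψ / w * w := by field_simp
        have l1 := mul_le_mul_of_nonneg_right (Nat.floor_le (a := ψ / w) (by positivity)) hw0.le
        have l2 := mul_lt_mul_of_pos_right (Nat.lt_floor_add_one (ψ / w)) hw0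
        rw [abs_le]
        simp only
        constructor <;> nlinarith
    _ = w ^ 2 := by simp

/-- Jordan's inequality for the sine at `π/2 - 2ψ` gives `|ψ - π/4| ≤ (π/4) |cos 2ψ|`. It needs `ψ ∈
[0, π/2]`, hence `ℓ ≠ 0`. The constant is `(π/4)² · 40 ≤ 5/8 · 40 = 25`. -/
theorem integral_nearestErr_const_le (b : ℕ) {ℓ : ℕ} (hℓ : ℓ ≠ 0) :
    ∫ ψ, nearestErr (fun _ : Fin (2 ^ b) => Real.pi / 4) ψ ∂(angleLaw ℓ) ≤ 25 / 2 ^ ℓ := by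
  have hπ := Real.pi_pos
  have hint : Integrable (fun ψ => (Real.pi / 4) ^ 2 * Real.cos (2 * ψ) ^ 2) (angleLaw ℓ) := by
    refine Integrable.of_bound (by fun_prop) ((Real.pi / 4) ^ 2) (ae_of_all _ fun ψ => ?_)
    rw [Real.norm_of_nonneg (by positivity)]
    exact mul_le_of_le_one_right (by positivity) (Real.cos_sq_le_one _)
  calc _ ≤ ∫ ψ, (Real.pi / 4) ^ 2 * Real.cos (2 * ψ) ^ 2 ∂(angleLaw ℓ) := by
        refine integral_mono_ae (integrable_nearestErr _) hint ?_
        filter_upwards [ae_mem_angleRange ℓ] with ψ hψ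
        rw [angleRange, if_neg hℓ] at hψ
        have h := Real.mul_abs_le_abs_sin (x := Real.pi / 2 - 2 * ψ)
          (by rw [abs_le]; constructor <;> linarith [hψ.1, hψ.2])
        rw [Real.sin_pi_div_two_sub] at h
        rw [nearestErr, sq_abs, ← mul_pow, sq_le_sq, abs_mul, abs_of_pos (a := Real.pi / 4)
          (by positivity)]
        have e : |Real.pi / 2 - 2 * ψ| = 2 * |ψ - Real.pi / 4| := by
          rw [← abs_two, ← abs_mul, abs_sub_comm, abs_two]
          congr 1
          ring
        rw [e] at h
        have := mul_le_mul_of_nonneg_left h (by positivity : 0 ≤ Real.pi / 4)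
        have e2 : Real.pi / 4 * (2 / Real.pi * (2 * |ψ - Real.pi / 4|)) = |ψ - Real.pi / 4| := by
          generalize |ψ - Real.pi / 4| = x
          field_simp
          ring
        rwa [e2] at this
    _ = (Real.pi / 4) ^ 2 * ∫ ψ, Real.cos (2 * ψ) ^ 2 ∂(angleLaw ℓ) := integral_const_mul _ _
    _ ≤ 5 / 8 * (40 / 2 ^ ℓ) := by
        gcongr
        · nlinarith [Real.pi_lt_d2]
        · exact integral_cos_two_mul_sq_angleLaw_le ℓ
    _ = 25 / 2 ^ ℓ := by ring

end Cost

/-! ### Bit count and numerical estimates -/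

section Numerics

theorem angleBits_le (t b : ℕ) : angleBits t b ≤ b * 2 ^ t := by
  have hcard : Nat.card (AngleCode t b) = 2 ^ (b * ∑ ℓ : Fin t, 2 ^ (t - 1 - (ℓ : ℕ))) := by
    rw [Nat.card_pi]
    simp only [Nat.card_eq_fintype_card, Fintype.card_pi, Finset.prod_const, Finset.card_univ,
      Fintype.card_fin, ← pow_mul]
    rw [Finset.prod_pow_eq_pow_sum, Finset.mul_sum]
  rw [angleBits, hcard, Nat.clog_pow _ _ Nat.one_lt_two]
  refine Nat.mul_le_mul_left _ ?_
  rw [Fin.sum_univ_eq_sum_range (fun ℓ => 2 ^ (t - 1 - ℓ)), Finset.sum_range_reflect (fun k => 2 ^ k)]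
  exact (Nat.geomSum_lt le_rfl fun k hk => Finset.mem_range.1 hk).le

/-- The induction step is `(1 - P)(1 - κ) ≥ 0`, so the factors may be negative. -/
theorem one_sub_prod_le_sum {κ a : ℕ → ℝ} {n : ℕ} (h0 : ∀ ℓ < n, |κ ℓ| ≤ 1)
    (h : ∀ ℓ < n, 1 - κ ℓ ≤ a ℓ) :
    1 - ∏ ℓ ∈ Finset.range n, κ ℓ ≤ ∑ ℓ ∈ Finset.range n, a ℓ := by
  induction n with
  | zero => simp
  | succ n ih =>
    have ih' := ih (fun ℓ hℓ => h0 ℓ (by omega)) (fun ℓ hℓ => h ℓ (by omega))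
    have hP : ∏ ℓ ∈ Finset.range n, κ ℓ ≤ 1 := by
      refine (le_abs_self _).trans ?_
      rw [Finset.abs_prod]
      exact Finset.prod_le_one (fun _ _ => abs_nonneg _)
        fun ℓ hℓ => h0 ℓ (by have := Finset.mem_range.1 hℓ; omega)
    have hn := h n (by omega)
    have hk := (abs_le.1 (h0 n (by omega))).2
    rw [Finset.prod_range_succ, Finset.sum_range_succ]
    nlinarith [mul_nonneg (sub_nonneg.2 hP) (sub_nonneg.2 hk)]

theorem sum_min_geometric_le {b : ℕ} {D : ℕ → ℝ} (n : ℕ)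
    (h1 : ∀ ℓ < n, D ℓ ≤ 40 / 4 ^ b) (h2 : ∀ ℓ < n, ℓ ≠ 0 → D ℓ ≤ 25 / 2 ^ ℓ) (hb : 1 ≤ b) :
    ∑ ℓ ∈ Finset.range n, D ℓ ≤ 130 / 2 ^ b := by
  -- At `ℓ = 2b` the decay `2 ^ ℓ` reaches `4 ^ b`. The head costs `80b / 4 ^ b` and the geometric
  -- tail at most `50 / 4 ^ b`; then `b ≤ 2 ^ b`.
  set d : ℕ → ℝ := fun ℓ => if ℓ < 2 * b then 40 / 4 ^ b else 25 / 2 ^ ℓ with hd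
  have hd0 : ∀ ℓ, 0 ≤ d ℓ := fun ℓ => by simp only [hd]; split_ifs <;> positivity
  have hDd : ∀ ℓ ∈ Finset.range n, D ℓ ≤ d ℓ := by
    intro ℓ hℓ
    have hℓ := Finset.mem_range.1 hℓ
    simp only [hd]
    split_ifs with h
    · exact h1 ℓ hℓ
    · exact h2 ℓ hℓ (by omega)
  have h4 : (4 : ℝ) ^ b = 2 ^ b * 2 ^ b := by rw [← mul_pow]; norm_num
  have hb2 : (b : ℝ) ≤ 2 ^ b := by exact_mod_cast (Nat.lt_two_pow_self (n := b)).le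
  have h2b : (1 : ℝ) ≤ 2 ^ b := one_le_pow₀ (by norm_num)
  calc ∑ ℓ ∈ Finset.range n, D ℓ ≤ ∑ ℓ ∈ Finset.range n, d ℓ := Finset.sum_le_sum hDd
    _ ≤ ∑ ℓ ∈ Finset.range (2 * b + n), d ℓ :=
        Finset.sum_le_sum_of_subset_of_nonneg (Finset.range_mono (by omega)) fun i _ _ => hd0 i
    _ = ∑ ℓ ∈ Finset.range (2 * b), d ℓ + ∑ k ∈ Finset.range n, d (2 * b + k) :=
        Finset.sum_range_add _ _ _
    _ = 2 * b * (40 / 4 ^ b) + 25 / 4 ^ b * ∑ k ∈ Finset.range n, (1 / (2 : ℝ)) ^ k := by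
        congr 1
        · rw [Finset.sum_congr rfl fun ℓ hℓ => if_pos (Finset.mem_range.1 hℓ)]
          simp
        · rw [Finset.mul_sum]
          refine Finset.sum_congr rfl fun k _ => ?_
          simp only [hd, if_neg (show ¬ 2 * b + k < 2 * b by omega)]
          rw [pow_add, pow_mul, one_div, inv_pow]
          norm_num
          field_simp
    _ ≤ 2 * b * (40 / 4 ^ b) + 25 / 4 ^ b * 2 := by
        gcongr
        exact sum_geometric_two_le n
    _ = (80 * b + 50) / 4 ^ b := by ring
    _ ≤ 130 / 2 ^ b := by
        rw [h4, div_le_div_iff₀ (by positivity) (by positivity)]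
        nlinarith [mul_nonneg (sub_nonneg.2 hb2) (by positivity : (0 : ℝ) ≤ 2 ^ b),
          mul_nonneg (sub_nonneg.2 h2b) (by positivity : (0 : ℝ) ≤ 2 ^ b)]

theorem exists_bitWidth {ε : ℝ} (h0 : 0 < ε) (h1 : ε ≤ 1 / 2) :
    ∃ b : ℕ, 1 ≤ b ∧ (130 : ℝ) / 2 ^ b ≤ ε ∧ (b : ℝ) ≤ 10 / Real.log 2 * Real.log (1 / ε) := by
  have hl2 : 0 < Real.log 2 := Real.log_pos one_lt_two
  set L := Real.log (1 / ε) / Real.log 2 with hL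
  have hL1 : 1 ≤ L := by
    rw [hL, le_div_iff₀ hl2, one_mul]
    refine Real.log_le_log (by norm_num) ?_
    rw [le_div_iff₀ h0]
    linarith
  have hm := Nat.le_ceil L
  have hm' := Nat.ceil_lt_add_one (a := L) (by linarith)
  -- `2 ^ 8` exceeds `130`, and `L ≥ 1` gives `⌈L⌉₊ + 8 ≤ L + 9 ≤ 10 L`.
  refine ⟨⌈L⌉₊ + 8, by omega, ?_, ?_⟩
  · have h : 1 / ε ≤ 2 ^ ⌈L⌉₊ := by
      rw [← Real.log_le_log_iff (by positivity) (by positivity), Real.log_pow]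
      rw [hL, div_le_iff₀ hl2] at hm
      exact hm
    rw [div_le_iff₀ h0] at h
    rw [div_le_iff₀ (by positivity), pow_add]
    nlinarith
  · push_cast
    rw [div_mul_eq_mul_div, mul_div_assoc, ← hL]
    linarith

end Numerics

/-! ### Expected inner product, level by level -/

section Expectation

variable {t : ℕ}

theorem integrable_norm_sq_stdGaussian (n : ℕ) :
    Integrable (fun y => ‖y‖ ^ 2) (stdGaussian (EuclideanSpace ℝ (Fin n))) :=
  (IsGaussian.memLp_two_id (μ := stdGaussian (EuclideanSpace ℝ (Fin n)))).integrable_norm_pow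
    two_ne_zero

theorem integral_norm_sq_stdGaussian (n : ℕ) :
    ∫ y, ‖y‖ ^ 2 ∂(stdGaussian (EuclideanSpace ℝ (Fin n))) = n := by
  have hi : ∀ i : Fin n, Integrable (fun y => y i ^ 2) (stdGaussian (EuclideanSpace ℝ (Fin n))) := by
    intro i
    refine (integrable_norm_sq_stdGaussian n).mono' (by fun_prop) (ae_of_all _ fun y => ?_)
    rw [Real.norm_of_nonneg (sq_nonneg _), EuclideanSpace.real_norm_sq_eq]
    exact Finset.single_le_sum (f := fun i => y i ^ 2) (fun i _ => sq_nonneg _) (Finset.mem_univ i)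
  simp_rw [EuclideanSpace.real_norm_sq_eq]
  rw [integral_finsetSum _ fun i _ => hi i]
  have : ∀ i : Fin n, ∫ y, y i ^ 2 ∂(stdGaussian (EuclideanSpace ℝ (Fin n))) = 1 := by
    intro i
    rw [← integral_sq_gaussianReal, ← map_apply_stdGaussian i,
      integral_map (by fun_prop) (by fun_prop)]
  simp [this]

/-- A crude bound, used for integrability only. -/
theorem abs_mul_polarRecon_le (q : ℕ → ℝ → ℝ) (m : ℕ) (R : ℕ → ℝ) {j : ℕ} (hj : j < 2 ^ m) :
    |R j * polarRecon q m R j| ≤ polarRadius R m 0 ^ 2 := by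
  have h1 : R j ^ 2 ≤ polarRadius R m 0 ^ 2 := by
    rw [polarRadius_sq]
    simp only [zero_mul, zero_add]
    exact Finset.single_le_sum (f := fun i => R i ^ 2) (fun i _ => sq_nonneg _)
      (Finset.mem_range.2 hj)
  have h2 : polarRecon q m R j ^ 2 ≤ polarRadius R m 0 ^ 2 := by
    rw [← sum_polarRecon_sq q]
    exact Finset.single_le_sum (f := fun i => polarRecon q m R i ^ 2) (fun i _ => sq_nonneg _)
      (Finset.mem_range.2 hj)
  rw [abs_le]
  constructor <;>
    nlinarith [sq_nonneg (R j + polarRecon q m R j), sq_nonneg (R j - polarRecon q m R j)]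

/-- The expected inner product of the radii of a level with their reconstruction, weighted by a
function of the norm. -/
theorem integral_mul_sum_polarRecon {q : ℕ → ℝ → ℝ} (hq : ∀ ℓ, Measurable (q ℓ)) {w : ℝ → ℝ}
    (hw : Measurable w) (hw1 : ∀ r, |w r| ≤ 1) (m ℓ : ℕ) (hm : ℓ + m = t) :
    ∫ y, w (polarRadius (coords y) t 0) * ∑ i ∈ Finset.range (2 ^ m),
        polarRadius (coords y) ℓ i *
          polarRecon (fun l => q (ℓ + l)) m (polarRadius (coords y) ℓ) i
        ∂(stdGaussian (EuclideanSpace ℝ (Fin (2 ^ t)))) =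
      (∏ l ∈ Finset.range m, ∫ ψ, Real.cos (ψ - q (ℓ + l) ψ) ∂(angleLaw (ℓ + l))) *
        ∫ y, w (polarRadius (coords y) t 0) * ‖y‖ ^ 2
          ∂(stdGaussian (EuclideanSpace ℝ (Fin (2 ^ t)))) := by
  induction m generalizing ℓ with
  | zero =>
    obtain rfl : ℓ = t := hm
    simp only [pow_zero, Finset.range_one, Finset.sum_singleton, Finset.range_zero,
      Finset.prod_empty, one_mul]
    refine integral_congr_ae (ae_of_all _ fun y => ?_)
    simp only
    rw [← polarRadius_coords_sq, sq]
    rfl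
  | succ m ih =>
    set μ := stdGaussian (EuclideanSpace ℝ (Fin (2 ^ t)))
    -- Everything but the cosine, as a function of the radii of level `ℓ + 1`. The weight belongs
    -- here because the final radius is determined by them (`htop`).
    set F : ℕ → (ℕ → ℝ) → ℝ := fun j R =>
      w (polarRadius R m 0) * (R j * polarRecon (fun l => q (ℓ + 1 + l)) m R j) with hF
    have hFm : ∀ j, Measurable (F j) := fun j =>
      (hw.comp (measurable_polarRadius m 0)).mul ((measurable_pi_apply j).mul
        (measurable_polarRecon (fun l => hq (ℓ + 1 + l)) m j))
    have htop : ∀ y : ℕ → ℝ, polarRadius y t 0 = polarRadius (polarRadius y (ℓ + 1)) m 0 := by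
      intro y
      rw [← polarRadius_add, ← hm]
      congr 1
      omega
    have hone : ∀ y : ℕ → ℝ, polarRadius (polarRadius y ℓ) 1 = polarRadius y (ℓ + 1) :=
      fun y => funext fun j => (polarRadius_add y ℓ 1 j).symm
    have hstep : ∀ y : EuclideanSpace ℝ (Fin (2 ^ t)),
        w (polarRadius (coords y) t 0) * ∑ i ∈ Finset.range (2 ^ (m + 1)),
          polarRadius (coords y) ℓ i *
            polarRecon (fun l => q (ℓ + l)) (m + 1) (polarRadius (coords y) ℓ) i =
        ∑ j ∈ Finset.range (2 ^ m), Real.cos (polarAngle (coords y) ℓ j -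
            q ℓ (polarAngle (coords y) ℓ j)) * F j (polarRadius (coords y) (ℓ + 1)) := by
      intro y
      rw [sum_mul_polarRecon_succ, Finset.mul_sum, hone, htop]
      refine Finset.sum_congr rfl fun j _ => ?_
      have e : (fun l => q (ℓ + (l + 1))) = fun l => q (ℓ + 1 + l) := by
        funext l; congr 1; ring
      rw [← polarAngle_add, e, hF]
      simp only [add_zero]
      ring
    have hFi : ∀ j < 2 ^ m, Integrable (fun y : EuclideanSpace ℝ (Fin (2 ^ t)) =>
        F j (polarRadius (coords y) (ℓ + 1))) μ := by
      intro j hj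
      refine (integrable_norm_sq_stdGaussian (2 ^ t)).mono' ((hFm j).comp
        (measurable_pi_lambda _ fun k => measurable_polarRadius_coords (ℓ + 1) k)).aestronglyMeasurable
        (ae_of_all _ fun y => ?_)
      rw [← polarRadius_coords_sq, htop, hF, Real.norm_eq_abs, abs_mul]
      exact (mul_le_of_le_one_left (abs_nonneg _) (hw1 _)).trans (abs_mul_polarRecon_le _ _ _ hj)
    have hcm : Measurable fun ψ => Real.cos (ψ - q ℓ ψ) := (measurable_id.sub (hq ℓ)).cos
    have hblock : ∀ j < 2 ^ m, (j + 1) * 2 ^ (ℓ + 1) ≤ 2 ^ t := by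
      intro j hj
      rw [← hm, show ℓ + (m + 1) = m + (ℓ + 1) by ring, pow_add 2 m]
      exact Nat.mul_le_mul_right _ hj
    -- Independence of the angle from these radii factors out the mean cosine, which is the same for
    -- all `j`.
    have hprod : ∀ j ∈ Finset.range (2 ^ m), ∫ y, Real.cos (polarAngle (coords y) ℓ j -
            q ℓ (polarAngle (coords y) ℓ j)) * F j (polarRadius (coords y) (ℓ + 1)) ∂μ =
        (∫ ψ, Real.cos (ψ - q ℓ ψ) ∂(angleLaw ℓ)) *
          ∫ y, F j (polarRadius (coords y) (ℓ + 1)) ∂μ := by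
      intro j hj
      have hj' := hblock j (Finset.mem_range.1 hj)
      rw [← map_polarAngle_coords ℓ j hj', integral_map
        (measurable_polarAngle_coords ℓ j).aemeasurable hcm.aestronglyMeasurable]
      exact (indepFun_polarAngle_polarRadius ℓ j hj').integral_fun_comp_mul_comp
        (f := fun ψ => Real.cos (ψ - q ℓ ψ)) (g := F j)
        (measurable_polarAngle_coords ℓ j).aemeasurable
        (measurable_pi_lambda _ fun k => measurable_polarRadius_coords (ℓ + 1) k).aemeasurable
        hcm.aestronglyMeasurable (hFm j).aestronglyMeasurable
    have hint : ∀ j ∈ Finset.range (2 ^ m), Integrable (fun y : EuclideanSpace ℝ (Fin (2 ^ t)) =>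
        Real.cos (polarAngle (coords y) ℓ j - q ℓ (polarAngle (coords y) ℓ j)) *
          F j (polarRadius (coords y) (ℓ + 1))) μ := by
      intro j hj
      refine (hFi j (Finset.mem_range.1 hj)).bdd_mul (c := 1)
        (hcm.comp (measurable_polarAngle_coords ℓ j)).aestronglyMeasurable
        (ae_of_all _ fun y => ?_)
      exact Real.abs_cos_le_one _
    simp_rw [hstep]
    rw [integral_finsetSum _ hint, Finset.sum_congr rfl hprod, ← Finset.mul_sum,
      ← integral_finsetSum _ fun j hj => hFi j (Finset.mem_range.1 hj), Finset.prod_range_succ']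
    have ih' := ih (ℓ + 1) (by omega)
    have e : ∏ l ∈ Finset.range m, ∫ ψ, Real.cos (ψ - q (ℓ + (l + 1)) ψ) ∂(angleLaw (ℓ + (l + 1))) =
        ∏ l ∈ Finset.range m, ∫ ψ, Real.cos (ψ - q (ℓ + 1 + l) ψ) ∂(angleLaw (ℓ + 1 + l)) :=
      Finset.prod_congr rfl fun l _ => by rw [show ℓ + (l + 1) = ℓ + 1 + l by ring]
    rw [e, add_zero, mul_right_comm, ← ih', mul_comm]
    congr 2
    funext y
    rw [htop, Finset.mul_sum]

end Expectation

/-! ### The orthogonal preconditioner -/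

section Transform

variable {n : Type*} [Fintype n] [DecidableEq n]

/-- Right multiplication by an orthogonal matrix as an isometry of the row vectors. -/
def vecMulIsometry (S : Matrix n n ℝ) (hS : S ∈ Matrix.orthogonalGroup n ℝ) :
    EuclideanSpace ℝ n ≃ₗᵢ[ℝ] EuclideanSpace ℝ n where
  toFun x := WithLp.toLp 2 (x.ofLp ᵥ* S)
  invFun x := WithLp.toLp 2 (x.ofLp ᵥ* Sᵀ)
  map_add' x y := by simp [Matrix.add_vecMul]
  map_smul' c x := by simp [Matrix.smul_vecMul]
  left_inv x := by
    have h : S * Sᵀ = 1 := (Matrix.mem_orthogonalGroup_iff n ℝ).1 hS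
    simp [Matrix.vecMul_vecMul, h]
  right_inv x := by
    have h : Sᵀ * S = 1 := (Matrix.mem_orthogonalGroup_iff' n ℝ).1 hS
    simp [Matrix.vecMul_vecMul, h]
  norm_map' x := by
    have h : S * Sᵀ = 1 := (Matrix.mem_orthogonalGroup_iff n ℝ).1 hS
    rw [← sq_eq_sq₀ (norm_nonneg _) (norm_nonneg _), EuclideanSpace.real_norm_sq_eq,
      EuclideanSpace.real_norm_sq_eq]
    have e : ∀ v : n → ℝ, ∑ i, v i ^ 2 = v ⬝ᵥ v := fun v => by simp [dotProduct, sq]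
    simp only [LinearEquiv.coe_mk, LinearMap.coe_mk, AddHom.coe_mk, e]
    rw [← Matrix.dotProduct_mulVec, ← Matrix.vecMul_transpose, Matrix.vecMul_vecMul, h,
      Matrix.vecMul_one]

end Transform

/-! ### The error as an inner product -/

section Error

variable {t b : ℕ} (Q : ∀ ℓ, AngleQuantizer b ℓ)

/-- The centroid nearest to `ψ`. -/
noncomputable def quantAngle (ℓ : ℕ) (ψ : ℝ) : ℝ := (Q ℓ).centroid (quantIndex (Q ℓ).centroid ψ)

theorem measurable_quantAngle (ℓ : ℕ) : Measurable (quantAngle Q ℓ) :=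
  measurable_centroid_quantIndex _

theorem integrable_cos_quantAngle (ℓ : ℕ) :
    Integrable (fun ψ => Real.cos (ψ - quantAngle Q ℓ ψ)) (angleLaw ℓ) :=
  Integrable.of_bound ((measurable_id.sub (measurable_quantAngle Q ℓ)).cos).aestronglyMeasurable 1
    (ae_of_all _ fun _ => Real.abs_cos_le_one _)

theorem abs_integral_cos_quantAngle_le (ℓ : ℕ) :
    |∫ ψ, Real.cos (ψ - quantAngle Q ℓ ψ) ∂(angleLaw ℓ)| ≤ 1 := by
  have := norm_integral_le_of_norm_le_const (μ := angleLaw ℓ) (C := 1)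
    (f := fun ψ => Real.cos (ψ - quantAngle Q ℓ ψ)) (ae_of_all _ fun _ => Real.abs_cos_le_one _)
  simpa using this

/-- Integrates `1 - cos u ≤ u² / 2`. -/
theorem one_sub_integral_cos_quantAngle_le (ℓ : ℕ) :
    1 - ∫ ψ, Real.cos (ψ - quantAngle Q ℓ ψ) ∂(angleLaw ℓ) ≤
      (∫ ψ, nearestErr (Q ℓ).centroid ψ ∂(angleLaw ℓ)) / 2 := by
  have h : ∫ ψ, (1 - Real.cos (ψ - quantAngle Q ℓ ψ)) ∂(angleLaw ℓ) ≤
      ∫ ψ, nearestErr (Q ℓ).centroid ψ / 2 ∂(angleLaw ℓ) := by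
    refine integral_mono ((integrable_const _).sub (integrable_cos_quantAngle Q ℓ))
      ((integrable_nearestErr _).div_const 2) fun ψ => ?_
    have := Real.one_sub_sq_div_two_le_cos (x := ψ - quantAngle Q ℓ ψ)
    simp only [nearestErr, sq_abs]
    change _ ≤ (ψ - quantAngle Q ℓ ψ) ^ 2 / 2
    linarith
  rw [integral_sub (integrable_const _) (integrable_cos_quantAngle Q ℓ), integral_div] at h
  simpa using h

/-- The inner product of `y` with the vector decoded from the quantized angles of `y`. -/
noncomputable def decodedInner (y : EuclideanSpace ℝ (Fin (2 ^ t))) : ℝ :=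
  ∑ i ∈ Finset.range (2 ^ t), coords y i * polarRecon (quantAngle Q) t (coords y) i

theorem measurable_decodedInner :
    Measurable (decodedInner Q : EuclideanSpace ℝ (Fin (2 ^ t)) → ℝ) :=
  Finset.measurable_fun_sum _ fun i _ => ((measurable_pi_apply i).comp measurable_coords).mul
    ((measurable_polarRecon (measurable_quantAngle Q) t i).comp measurable_coords)

theorem abs_decodedInner_le (y : EuclideanSpace ℝ (Fin (2 ^ t))) :
    |decodedInner Q y| ≤ 2 ^ t * ‖y‖ ^ 2 := by
  refine (Finset.abs_sum_le_sum_abs _ _).trans ?_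
  refine (Finset.sum_le_sum fun i hi =>
    abs_mul_polarRecon_le (quantAngle Q) t (coords y) (Finset.mem_range.1 hi)).trans ?_
  simp [polarRadius_coords_sq]

/-- Both the rotation and the decoding preserve norms, so expanding the square leaves only the inner
product unknown. -/
theorem norm_sub_polarDequant_sq (S : Matrix (Fin (2 ^ t)) (Fin (2 ^ t)) ℝ)
    (hS : S ∈ Matrix.orthogonalGroup (Fin (2 ^ t)) ℝ) (x : EuclideanSpace ℝ (Fin (2 ^ t))) :
    ‖x - polarDequant Q S (polarQuant Q S x)‖ ^ 2 =
      2 * ‖x‖ ^ 2 - 2 * decodedInner Q (vecMulIsometry S hS x) := by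
  set U := vecMulIsometry S hS
  set y := U x with hy
  set z : EuclideanSpace ℝ (Fin (2 ^ t)) :=
    WithLp.toLp 2 fun i : Fin (2 ^ t) => polarRecon (quantAngle Q) t (coords y) i with hz
  have h1 : polarDequant Q S (polarQuant Q S x) = U.symm z := by
    have e : (fun i : Fin (2 ^ t) => polarInv t (polarQuant Q S x).1
        (codeAngle Q (polarQuant Q S x).2) i) =
        fun i : Fin (2 ^ t) => polarRecon (quantAngle Q) t (coords y) i := by
      funext i
      -- Only positions of actual angles are read, so the default `0` in `codeAngle` is harmless.
      refine polarInv_congr _ (fun l hl k hk => ?_) i.2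
      simp only [codeAngle, hl, hk, dif_pos]
      rfl
    rw [polarDequant, e]
    rfl
  have h2 : ‖x - U.symm z‖ = ‖y - z‖ := by
    rw [← U.norm_map, map_sub, U.apply_symm_apply]
  have h3 : ‖z‖ ^ 2 = ‖y‖ ^ 2 := by
    rw [EuclideanSpace.real_norm_sq_eq, ← polarRadius_coords_sq, ← sum_polarRecon_sq (quantAngle Q),
      Finset.sum_range]
  have h4 : inner ℝ y z = decodedInner Q y := by
    rw [decodedInner, Finset.sum_range, PiLp.inner_apply]
    refine Finset.sum_congr rfl fun i _ => ?_
    simp [coords, hz, mul_comm]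
  rw [h1, h2, norm_sub_sq_real, h3, h4, hy, U.norm_map]
  ring

end Error

/-! ### Conditional error and conclusion -/

section Main

variable {t b : ℕ}

theorem integrable_decodedInner (Q : ∀ ℓ, AngleQuantizer b ℓ) :
    Integrable (decodedInner Q) (stdGaussian (EuclideanSpace ℝ (Fin (2 ^ t)))) :=
  ((integrable_norm_sq_stdGaussian (2 ^ t)).const_mul (2 ^ t)).mono'
    (measurable_decodedInner Q).aestronglyMeasurable (ae_of_all _ (abs_decodedInner_le Q))

/-- The weight is the indicator of `A` evaluated at the norm; rotation invariance of the Gaussian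
measure removes `U`. -/
theorem setIntegral_decodedInner (ht : t ≠ 0) (Q : ∀ ℓ, AngleQuantizer b ℓ)
    (U : EuclideanSpace ℝ (Fin (2 ^ t)) ≃ₗᵢ[ℝ] EuclideanSpace ℝ (Fin (2 ^ t)))
    {A : Set ℝ} (hA : MeasurableSet A) :
    ∫ x in (fun x => ‖x‖) ⁻¹' A, decodedInner Q (U x)
        ∂(stdGaussian (EuclideanSpace ℝ (Fin (2 ^ t)))) =
      (∏ ℓ ∈ Finset.range t, ∫ ψ, Real.cos (ψ - quantAngle Q ℓ ψ) ∂(angleLaw ℓ)) *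
        ∫ x in (fun x => ‖x‖) ⁻¹' A, ‖x‖ ^ 2 ∂(stdGaussian (EuclideanSpace ℝ (Fin (2 ^ t)))) := by
  set μ := stdGaussian (EuclideanSpace ℝ (Fin (2 ^ t)))
  set w : ℝ → ℝ := A.indicator 1 with hw
  have hwm : Measurable w := measurable_one.indicator hA
  have hw1 : ∀ r, |w r| ≤ 1 := fun r => by
    simp only [hw, Set.indicator]; split_ifs <;> simp
  have hset : ∀ f : EuclideanSpace ℝ (Fin (2 ^ t)) → ℝ,
      ∫ x in (fun x => ‖x‖) ⁻¹' A, f x ∂μ = ∫ x, w ‖x‖ * f x ∂μ := by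
    intro f
    rw [← integral_indicator (measurable_norm hA)]
    congr 1
    funext x
    by_cases h : ‖x‖ ∈ A <;> simp [hw, Set.indicator, h]
  have key := integral_mul_sum_polarRecon (t := t) (measurable_quantAngle Q) hwm hw1 t 0 (zero_add t)
  simp only [zero_add, polarRadius_coords ht] at key
  rw [hset, hset, ← key]
  have hmap : ∫ y, w ‖y‖ * decodedInner Q y ∂(μ.map U) = ∫ x, w ‖U x‖ * decodedInner Q (U x) ∂μ :=
    integral_map U.continuous.aemeasurable
      ((hwm.comp measurable_norm).mul (measurable_decodedInner Q)).aestronglyMeasurable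
  rw [stdGaussian_map] at hmap
  simp only [U.norm_map] at hmap
  rw [← hmap]
  rfl

/-- Optimality puts each level below both the uniform grid, where `4π² ≤ 40`, and, for `ℓ ≠ 0`, the
constant centroid `π/4`. -/
theorem two_sub_two_mul_prod_le {ε : ℝ} (hb : 1 ≤ b) (hε : (130 : ℝ) / 2 ^ b ≤ ε)
    (Q : ∀ ℓ, AngleQuantizer b ℓ) (hQ : ∀ ℓ < t, (Q ℓ).IsOptimal) :
    2 - 2 * ∏ ℓ ∈ Finset.range t, ∫ ψ, Real.cos (ψ - quantAngle Q ℓ ψ) ∂(angleLaw ℓ) ≤ ε := by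
  set D : ℕ → ℝ := fun ℓ => ∫ ψ, nearestErr (Q ℓ).centroid ψ ∂(angleLaw ℓ)
  have h1 := one_sub_prod_le_sum (n := t) (a := fun ℓ => D ℓ / 2)
    (fun ℓ _ => abs_integral_cos_quantAngle_le Q ℓ)
    (fun ℓ _ => one_sub_integral_cos_quantAngle_le Q ℓ)
  rw [← Finset.sum_div] at h1
  have h2 : ∑ ℓ ∈ Finset.range t, D ℓ ≤ 130 / 2 ^ b := by
    refine sum_min_geometric_le t (fun ℓ hℓ => ?_) (fun ℓ hℓ h0 => ?_) hb
    · refine ((hQ ℓ hℓ).integral_nearestErr_le _).trans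
        ((integral_nearestErr_uniform_le b ℓ).trans ?_)
      rw [div_pow, ← pow_mul, mul_comm b, pow_mul]
      norm_num
      gcongr
      nlinarith [Real.pi_lt_d2, Real.pi_pos]
    · exact ((hQ ℓ hℓ).integral_nearestErr_le _).trans (integral_nearestErr_const_le b h0)
  linarith

end Main

theorem mainTheorem1 :
    ∃ C : ℝ, 0 < C ∧ ∀ ε : ℝ, 0 < ε → ε ≤ 1 / 2 →
      ∃ b : ℕ,
        (∃ Q : ∀ ℓ, AngleQuantizer b ℓ, ∀ ℓ, (Q ℓ).IsOptimal) ∧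
        ∀ t : ℕ, 1 ≤ t →
          -- bits for the angle indices of a vector of dimension `d = 2 ^ t`
          (angleBits t b : ℝ) ≤ C * Real.log (1 / ε) * 2 ^ t ∧
          ∀ Q : ∀ ℓ, AngleQuantizer b ℓ, (∀ ℓ < t, (Q ℓ).IsOptimal) →
          ∀ S ∈ Matrix.orthogonalGroup (Fin (2 ^ t)) ℝ,
            -- the only other stored quantity is the norm
            (∀ x : EuclideanSpace ℝ (Fin (2 ^ t)), (polarQuant Q S x).1 = ‖x‖) ∧
            Integrable
              (fun x : EuclideanSpace ℝ (Fin (2 ^ t)) =>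
                ‖x - polarDequant Q S (polarQuant Q S x)‖ ^ 2)
              (stdGaussian (EuclideanSpace ℝ (Fin (2 ^ t)))) ∧
            -- conditional expectation given the norm
            (stdGaussian (EuclideanSpace ℝ (Fin (2 ^ t))))[
                fun x => ‖x - polarDequant Q S (polarQuant Q S x)‖ ^ 2 |
                MeasurableSpace.comap (fun x : EuclideanSpace ℝ (Fin (2 ^ t)) => ‖x‖) inferInstance]
              ≤ᵐ[stdGaussian (EuclideanSpace ℝ (Fin (2 ^ t)))] (fun x => ε * ‖x‖ ^ 2) ∧
            ∫ x, ‖x - polarDequant Q S (polarQuant Q S x)‖ ^ 2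
                ∂(stdGaussian (EuclideanSpace ℝ (Fin (2 ^ t)))) ≤ ε * 2 ^ t := by
  refine ⟨10 / Real.log 2, div_pos (by norm_num) (Real.log_pos one_lt_two), fun ε h0 h1 => ?_⟩
  obtain ⟨b, hb, hbε, hbl⟩ := exists_bitWidth h0 h1
  choose Q₀ hQ₀ using AngleQuantizer.exists_isOptimal b
  refine ⟨b, ⟨Q₀, hQ₀⟩, fun t ht => ⟨?_, fun Q hQ S hS => ?_⟩⟩
  · refine le_trans ?_ (mul_le_mul_of_nonneg_right hbl (by positivity))
    exact_mod_cast angleBits_le t b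
  -- For `t = 0` the final radius would be a signed coordinate instead of the norm.
  have ht0 : t ≠ 0 := by omega
  set μ := stdGaussian (EuclideanSpace ℝ (Fin (2 ^ t)))
  set U := vecMulIsometry S hS
  set P := ∏ ℓ ∈ Finset.range t, ∫ ψ, Real.cos (ψ - quantAngle Q ℓ ψ) ∂(angleLaw ℓ)
  have hP : 2 - 2 * P ≤ ε := two_sub_two_mul_prod_le hb hbε Q hQ
  have hsq : Integrable (fun x => ‖x‖ ^ 2) μ := integrable_norm_sq_stdGaussian (2 ^ t)
  have hIU : Integrable (fun x => decodedInner Q (U x)) μ := by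
    have h := integrable_decodedInner (t := t) Q
    rw [← stdGaussian_map U] at h
    exact h.comp_aemeasurable U.continuous.aemeasurable
  have hint : Integrable (fun x => 2 * ‖x‖ ^ 2 - 2 * decodedInner Q (U x)) μ :=
    (hsq.const_mul 2).sub (hIU.const_mul 2)
  -- Equal integrals over all events of the norm identify the conditional expectation as exactly `(2
  -- - 2P)‖x‖²`; the full event gives the mean error.
  have hset : ∀ A : Set ℝ, MeasurableSet A →
      ∫ x in (fun x => ‖x‖) ⁻¹' A, (2 - 2 * P) * ‖x‖ ^ 2 ∂μ =
        ∫ x in (fun x => ‖x‖) ⁻¹' A, (2 * ‖x‖ ^ 2 - 2 * decodedInner Q (U x)) ∂μ := by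
    intro A hA
    rw [integral_sub (hsq.const_mul 2).integrableOn (hIU.const_mul 2).integrableOn,
      integral_const_mul, integral_const_mul, integral_const_mul, setIntegral_decodedInner ht0 Q U hA]
    ring
  simp only [norm_sub_polarDequant_sq Q S hS]
  refine ⟨fun x => ?_, hint, ?_, ?_⟩
  · change polarRadius (coords (U x)) t 0 = ‖x‖
    rw [polarRadius_coords ht0, U.norm_map]
  · have hm : MeasurableSpace.comap (fun x : EuclideanSpace ℝ (Fin (2 ^ t)) => ‖x‖) inferInstance ≤
        (inferInstance : MeasurableSpace (EuclideanSpace ℝ (Fin (2 ^ t)))) :=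
      measurable_norm.comap_le
    have hce := ae_eq_condExp_of_forall_setIntegral_eq (μ := μ) hm hint
      (g := fun x => (2 - 2 * P) * ‖x‖ ^ 2) (fun s _ _ => (hsq.const_mul _).integrableOn)
      (by rintro s ⟨A, hA, rfl⟩ _; exact hset A hA)
      (((comap_measurable _).pow_const 2).const_mul _).aestronglyMeasurable
    filter_upwards [hce] with x hx
    rw [← hx]
    gcongr
  · have h := hset Set.univ .univ
    simp only [Set.preimage_univ, setIntegral_univ] at h
    rw [← h, integral_const_mul, integral_norm_sq_stdGaussian]
    push_cast
    gcongr
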